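/- Let $G$ be a finite simple undirected graph on $n$ vertices. Let $S(G)$ be the set of real symmetric $n\times n$ matrices $A$, indexed by the vertices, such that for $i\neq j$ the entry $a_{ij}$ is nonzero if and only if $ij$ is an edge of $G$ (the diagonal is unrestricted). Let $M(G)$ be the maximum, over $A\in S(G)$, of the largest multiplicity of an eigenvalue of $A$. $G$ is a *$C_2$ graph* if it is connected and every vertex has degree at least two. $G$ is a *SEAC graph* (singly edge-articulated cycle graph) if it can be built sequentially, starting from a single cycle, by gluing each successive cycle along an edge of the previously built graph (the new cycle and the previous graph have exactly this edge and its two end vertices in common), where no edge is used more than once as such an edge of articulation. Two distinct constituent cycles of such a construction are *neighbors* if they share an edge of articulation. A SEAC graph is *linear* (an *LSEAC graph*) if, in every such construction, each constituent cycle has at most two neighbors. Then: 1. If $G$ is a $C_2$ graph and $M(G)=2$, then $G$ is a SEAC graph and, moreover, an LSEAC graph. 2. If $G$ is a SEAC graph and, in some construction of $G$ as above, a constituent cycle has exactly $k\ge 3$ neighbors, then $M(G)\ge k$. -/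

import Mathlib

/-- `S(G)`: the real symmetric matrices whose graph is `G`. The diagonal is unrestricted. -/
def symMatricesOf {V : Type*} (G : SimpleGraph V) : Set (Matrix V V ℝ) :=
  {A | A.IsSymm ∧ ∀ i j, i ≠ j → (A i j ≠ 0 ↔ G.Adj i j)}

/-- `M(A)`: the largest multiplicity of an eigenvalue of `A`. For a real symmetric matrix all
eigenvalues are real, and the multiplicity of `μ` is the dimension of its eigenspace
(real numbers that are not eigenvalues contribute `0`). -/
noncomputable def maxMultMatrix {V : Type*} [Fintype V] (A : Matrix V V ℝ) : ℕ :=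
  ⨆ μ : ℝ, Module.finrank ℝ (Module.End.eigenspace A.mulVecLin μ)

/-- `M(G)`: the maximum of `M(A)` over all `A ∈ S(G)`. -/
noncomputable def maxMult {V : Type*} [Fintype V] (G : SimpleGraph V) : ℕ :=
  sSup (maxMultMatrix '' symMatricesOf G)

/-- A `C₂` graph: connected, and no vertex has degree less than two. -/
def IsC2 {V : Type*} [Fintype V] (G : SimpleGraph V) [DecidableRel G.Adj] : Prop :=
  G.Connected ∧ ∀ v, 2 ≤ G.degree v

/-- A subgraph that is a (simple) cycle: it consists of the vertices and edges of a cyclic walk. -/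
def IsCycleSubgraph {V : Type*} {G : SimpleGraph V} (Z : G.Subgraph) : Prop :=
  ∃ (u : V) (p : G.Walk u u), p.IsCycle ∧ p.toSubgraph = Z

/-- `SEACBuild H C E`: the graph `H` is sequentially built from the cycles in `C`, starting
with a single cycle and gluing each successive cycle along an edge of the previous graph; `E` is
the set of edges of articulation, none of which is used more than once for articulation.
The new cycle and the previous graph have exactly the articulation edge (and its two end
vertices) in common, and the new graph has no edges besides those of these two graphs. -/
inductive SEACBuild {V : Type*} {G : SimpleGraph V} :
    G.Subgraph → Set G.Subgraph → Set (Sym2 V) → Prop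
  | cycle (Z : G.Subgraph) (hZ : IsCycleSubgraph Z) : SEACBuild Z {Z} ∅
  | glue (H : G.Subgraph) (C : Set G.Subgraph) (E : Set (Sym2 V)) (Z : G.Subgraph) (u v : V)
      (hH : SEACBuild H C E) (hZ : IsCycleSubgraph Z)
      (huvH : H.Adj u v) (huvZ : Z.Adj u v)
      (hverts : H.verts ∩ Z.verts = {u, v})
      (hnew : s(u, v) ∉ E) :
      SEACBuild (H ⊔ Z) (insert Z C) (insert s(u, v) E)

/-- `C` and `E` are the constituent cycles and the edges of articulation of a construction of the
whole graph `G` as a singly edge-articulated cycle graph. -/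
def IsSEACConstruction {V : Type*} (G : SimpleGraph V) (C : Set G.Subgraph)
    (E : Set (Sym2 V)) : Prop :=
  SEACBuild (⊤ : G.Subgraph) C E

/-- `G` is a SEAC (singly edge-articulated cycle) graph. -/
def IsSEAC {V : Type*} (G : SimpleGraph V) : Prop :=
  ∃ (C : Set G.Subgraph) (E : Set (Sym2 V)), IsSEACConstruction G C E

/-- The neighbors of the cycle `Z` among the cycles in `C`: the other cycles in `C` that share
an edge of articulation with `Z`. -/
def cycleNeighbors {V : Type*} {G : SimpleGraph V} (C : Set G.Subgraph) (E : Set (Sym2 V))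
    (Z : G.Subgraph) : Set G.Subgraph :=
  {Z' | Z' ∈ C ∧ Z' ≠ Z ∧ ∃ e ∈ E, e ∈ Z.edgeSet ∧ e ∈ Z'.edgeSet}

/-- `G` is an LSEAC (linear SEAC) graph: it is a SEAC graph, and each of its constituent cycles
has at most two neighbors. The latter is required in every construction of `G`, so that it
does not rest on the constituent cycles being well defined. -/
def IsLSEAC {V : Type*} (G : SimpleGraph V) : Prop :=
  IsSEAC G ∧ ∀ (C : Set G.Subgraph) (E : Set (Sym2 V)), IsSEACConstruction G C E →
    ∀ Z ∈ C, (cycleNeighbors C E Z).ncard ≤ 2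

/-!
Both parts rest on lower bounds for `M(G)`, that is, on symmetric matrices with pattern `G` and
large nullity.

*Gluing.* Rank is subadditive. If two graphs on vertex sets `U₁`, `U₂` carry matrices of nullities
`k₁`, `k₂`, then a generic combination of the two has the pattern of the union and nullity at least
`k₁ + k₂ - |U₁ ∩ U₂|` (`HasNullity.glue`). The pieces are of two kinds: signless Laplacians, of
nullity at least `|U| - #edges`, and matrices of nullity two on any graph with a non-cut vertex of
degree at least two (`hasNullity_two_of_connected_delete`), in particular on cycles. Gluing cycles
at edges keeps nullity two, so every SEAC graph has it. For a constituent cycle `Z` with `k` edges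
of articulation, start instead with the `k` disjoint paths which are left of `Z` after removal of
these edges. They have nullity `k`, and gluing on the remaining constituents restores the removed
edges without loss of nullity (`SEACBuild.hasNullity_deleteEdges`). A cycle has at most one neighbor
for each of its edges of articulation, which gives the second part, and the linearity in the first.

*Nonlinear part.* For a `C₂` graph with `M(G) = 2`, gluing two matrices of nullity two at a cut
vertex would give nullity three, so `G` is 2-connected. Further, `G` contains neither `K₄` nor a
subdivision of `K₂,₃` (three disjoint connected sets joined to the same two vertices). Such a
subgraph carries a matrix of nullity three with the Strong Arnold Property, and by transversality
(`card_le_maxMult_of_strongArnold`) the nullity survives the addition of the other edges and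
vertices of `G`.

*Building the graph.* In a SEAC graph the edges which are not edges of articulation form a
Hamiltonian cycle (`SEACBuild.exists_hamiltonian`), so two vertices which are not joined by such an
edge are the ends of two disjoint arcs, and an ear attached at them would give a subdivision of
`K₂,₃`. Hence a shortest ear of an induced SEAC subgraph can be glued on as a new cycle, and the
result is again induced (`exists_cycle_of_two_connected`). This continues until all of `G` is built.
-/

/-! ### Lower bounds for `M(G)` and gluing of matrices -/

open Matrix in
/-- A lower bound for `M(G)`: the nullity of any matrix in `S(G)`. -/
theorem finrank_ker_le_maxMult {V : Type*} [Fintype V] {G : SimpleGraph V} {A : Matrix V V ℝ}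
    (hA : A ∈ symMatricesOf G) : Module.finrank ℝ (LinearMap.ker A.mulVecLin) ≤ maxMult G := by
  have hbd : ∀ B : Matrix V V ℝ, ∀ μ : ℝ,
      Module.finrank ℝ (Module.End.eigenspace B.mulVecLin μ) ≤ Fintype.card V := fun B μ =>
    (Submodule.finrank_le _).trans (by simp)
  have h1 : Module.finrank ℝ (LinearMap.ker A.mulVecLin) ≤ maxMultMatrix A := by
    rw [← Module.End.eigenspace_zero]
    exact le_ciSup (f := fun μ : ℝ => Module.finrank ℝ (Module.End.eigenspace A.mulVecLin μ))
      ⟨Fintype.card V, by rintro _ ⟨μ, rfl⟩; exact hbd A μ⟩ 0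
  refine h1.trans (le_csSup ⟨Fintype.card V, ?_⟩ ⟨A, hA, rfl⟩)
  rintro _ ⟨B, -, rfl⟩
  exact ciSup_le fun μ => hbd B μ

open Matrix in
theorem card_sub_rank_le_maxMult {V : Type*} [Fintype V] {G : SimpleGraph V} {A : Matrix V V ℝ}
    (hA : A ∈ symMatricesOf G) {k : ℕ} (hk : A.rank + k ≤ Fintype.card V) : k ≤ maxMult G := by
  have h1 := finrank_ker_le_maxMult hA
  have h2 := LinearMap.finrank_range_add_finrank_ker A.mulVecLin
  rw [Module.finrank_fintype_fun_eq_card] at h2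
  change A.rank + _ = _ at h2
  omega

/-- `HasNullity K U k`: some real symmetric matrix supported on `U × U`, whose off-diagonal nonzero
pattern is the graph `K`, has nullity at least `k` when regarded as a matrix indexed by `U`.
The nullity is expressed through the rank, which does not change when a matrix is padded
with zeros. -/
def HasNullity {V : Type*} [Fintype V] (K : SimpleGraph V) (U : Set V) (k : ℕ) : Prop :=
  ∃ A : Matrix V V ℝ, A.IsSymm ∧ (∀ i j, A i j ≠ 0 → i ∈ U ∧ j ∈ U) ∧
    (∀ i j, i ≠ j → (A i j ≠ 0 ↔ K.Adj i j)) ∧ A.rank + k ≤ U.ncard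

theorem HasNullity.le_maxMult {V : Type*} [Fintype V] {G : SimpleGraph V} {k : ℕ}
    (h : HasNullity G Set.univ k) : k ≤ maxMult G := by
  obtain ⟨A, hs, -, hp, hr⟩ := h
  refine card_sub_rank_le_maxMult (A := A) ⟨hs, hp⟩ ?_
  simpa [Set.ncard_univ, Nat.card_eq_fintype_card] using hr

theorem Matrix.rank_add_le_real {V : Type*} [Fintype V] (A B : Matrix V V ℝ) :
    (A + B).rank ≤ A.rank + B.rank := by
  unfold Matrix.rank
  rw [Matrix.mulVecLin_add]
  refine (Submodule.finrank_mono (LinearMap.range_add_le _ _)).trans ?_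
  exact Submodule.finrank_add_le_finrank_add_finrank _ _

/-- A scalar `c ≠ 0` for which no entry cancels in `A + c • B`. -/
theorem Matrix.exists_smul_add_ne_zero {V : Type*} [Fintype V] (A B : Matrix V V ℝ) :
    ∃ c : ℝ, ∀ i j, (A + c • B) i j ≠ 0 ↔ A i j ≠ 0 ∨ B i j ≠ 0 := by
  classical
  obtain ⟨c, hc⟩ := Infinite.exists_notMem_finset
    (insert (0 : ℝ) (Finset.univ.image fun p : V × V => -A p.1 p.2 / B p.1 p.2))
  simp only [Finset.mem_insert, Finset.mem_image, Finset.mem_univ, true_and, not_or,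
    not_exists, Prod.forall] at hc
  refine ⟨c, fun i j => ?_⟩
  simp only [Matrix.add_apply, Matrix.smul_apply, smul_eq_mul]
  by_cases hB : B i j = 0
  · simp [hB]
  · refine iff_of_true (fun h => hc.2 i j ?_) (Or.inr hB)
    rw [div_eq_iff hB]; linarith

/-- Gluing: ranks are subadditive, so nullities add up except for the size of the overlap. -/
theorem HasNullity.glue {V : Type*} [Fintype V] {K₁ K₂ : SimpleGraph V} {U₁ U₂ : Set V}
    {k₁ k₂ k : ℕ} (h₁ : HasNullity K₁ U₁ k₁) (h₂ : HasNullity K₂ U₂ k₂)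
    (hk : k + (U₁ ∩ U₂).ncard ≤ k₁ + k₂) : HasNullity (K₁ ⊔ K₂) (U₁ ∪ U₂) k := by
  obtain ⟨A, hAs, hAU, hAK, hAr⟩ := h₁
  obtain ⟨B, hBs, hBU, hBK, hBr⟩ := h₂
  obtain ⟨c, hc⟩ := Matrix.exists_smul_add_ne_zero A B
  refine ⟨A + c • B, hAs.add (hBs.smul c), fun i j h => ?_, fun i j hij => ?_, ?_⟩
  · rcases (hc i j).1 h with h | h
    · exact ⟨Or.inl (hAU i j h).1, Or.inl (hAU i j h).2⟩
    · exact ⟨Or.inr (hBU i j h).1, Or.inr (hBU i j h).2⟩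
  · rw [hc, hAK i j hij, hBK i j hij, SimpleGraph.sup_adj]
  · have h1 := Matrix.rank_add_le_real A (c • B)
    have h2 : (c • B).rank ≤ B.rank := by
      classical
      rw [show c • B = (c • (1 : Matrix V V ℝ)) * B by simp]
      exact Matrix.rank_mul_le_right _ _
    have h3 := Set.ncard_union_add_ncard_inter U₁ U₂ (Set.toFinite _) (Set.toFinite _)
    omega

theorem HasNullity.congr {V : Type*} [Fintype V] {K K' : SimpleGraph V} {U U' : Set V} {k k' : ℕ}
    (h : HasNullity K U k) (hK : K = K') (hU : U = U') (hk : k = k') : HasNullity K' U' k' := by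
  subst hK hU hk; exact h

/-- The signless Laplacian of a graph with few edges has large nullity: it is `N * Nᵀ` for the
incidence matrix `N`, which has one column for each edge. -/
theorem hasNullity_of_card_edgeSet {V : Type*} [Fintype V] (K : SimpleGraph V) (U : Set V) (k : ℕ)
    (hU : ∀ i j, K.Adj i j → i ∈ U) (hk : K.edgeSet.ncard + k ≤ U.ncard) :
    HasNullity K U k := by
  classical
  let N : Matrix V K.edgeSet ℝ := Matrix.of fun i e => if i ∈ e.1 then 1 else 0
  have hN : ∀ i j, (N * N.transpose) i j =
      ∑ e : K.edgeSet, if i ∈ e.1 ∧ j ∈ e.1 then (1 : ℝ) else 0 := fun i j => by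
    rw [Matrix.mul_apply]
    refine Finset.sum_congr rfl fun e _ => ?_
    by_cases h1 : i ∈ e.1 <;> by_cases h2 : j ∈ e.1 <;> simp [N, h1, h2]
  have hN' : ∀ i j, (N * N.transpose) i j ≠ 0 ↔ ∃ e ∈ K.edgeSet, i ∈ e ∧ j ∈ e := fun i j => by
    rw [hN, Ne, Finset.sum_eq_zero_iff_of_nonneg (fun e _ => by split_ifs <;> norm_num)]
    simp
  have hmem : ∀ e ∈ K.edgeSet, ∀ i ∈ e, i ∈ U := by
    intro e
    induction e with
    | _ x y =>
      intro he i hi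
      rw [SimpleGraph.mem_edgeSet] at he
      rcases Sym2.mem_iff.1 hi with rfl | rfl
      · exact hU _ _ he
      · exact hU _ _ he.symm
  refine ⟨N * N.transpose, by simp [Matrix.IsSymm, Matrix.transpose_mul], fun i j h => ?_,
    fun i j hij => ?_, ?_⟩
  · obtain ⟨e, he, hi, hj⟩ := (hN' i j).1 h
    exact ⟨hmem e he i hi, hmem e he j hj⟩
  · rw [hN']
    constructor
    · rintro ⟨e, he, hi, hj⟩
      rwa [(Sym2.mem_and_mem_iff hij).1 ⟨hi, hj⟩] at he
    · intro h
      exact ⟨s(i, j), h, by simp, by simp⟩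
  · have h1 := (Matrix.rank_mul_le_left N N.transpose).trans N.rank_le_card_width
    rw [← Nat.card_eq_fintype_card, Nat.card_coe_set_eq] at h1
    omega

/-! ### A matrix of nullity two from a non-cut vertex -/

/-- Fredholm alternative for a real symmetric matrix. -/
theorem Matrix.IsSymm.exists_mulVec_eq {V : Type*} [Fintype V] {M : Matrix V V ℝ} (hM : M.IsSymm)
    (b : V → ℝ) (hb : ∀ y, M.mulVec y = 0 → y ⬝ᵥ b = 0) : ∃ g, M.mulVec g = b := by
  classical
  by_contra hcon
  have hb' : b ∉ LinearMap.range M.mulVecLin := by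
    rintro ⟨g, hg⟩
    exact hcon ⟨g, hg⟩
  obtain ⟨f, hf, hfM⟩ := Submodule.exists_le_ker_of_notMem hb'
  have hfd : ∀ x, f x = (fun i => f (Pi.single i 1)) ⬝ᵥ x := fun x => by
    conv_lhs => rw [pi_eq_sum_univ' x, map_sum]
    simp only [map_smul, smul_eq_mul, dotProduct]
    refine Finset.sum_congr rfl fun i _ => ?_
    rw [mul_comm]
  refine hf ?_
  rw [hfd]
  refine hb _ ?_
  refine dotProduct_eq_zero _ fun x => ?_
  have : f (M.mulVec x) = 0 := hfM ⟨x, rfl⟩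
  rw [hfd, Matrix.dotProduct_mulVec, ← Matrix.mulVec_transpose, hM.eq] at this
  exact this

/-- A matrix supported on `U × U` which kills two vectors that are independent on `U` has
nullity at least two on `U`. -/
theorem Matrix.rank_add_two_le {V : Type*} [Fintype V] {A : Matrix V V ℝ} {U : Set V}
    (hA : ∀ i j, A i j ≠ 0 → i ∈ U ∧ j ∈ U) {y z : V → ℝ} (hy : A.mulVec y = 0)
    (hz : A.mulVec z = 0)
    (hind : ∀ s t : ℝ, (∀ i ∈ U, s * y i + t * z i = 0) → s = 0 ∧ t = 0) :
    A.rank + 2 ≤ U.ncard := by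
  classical
  let q : ((↥(Uᶜ) → ℝ) × ℝ × ℝ) →ₗ[ℝ] (V → ℝ) :=
    { toFun := fun p i => (if h : i ∈ U then 0 else p.1 ⟨i, h⟩) + p.2.1 * y i + p.2.2 * z i
      map_add' := fun p p' => by
        ext i; by_cases h : i ∈ U <;> simp [h] <;> ring
      map_smul' := fun c p => by
        ext i; by_cases h : i ∈ U <;> simp [h] <;> ring }
  have hq : Function.Injective q := by
    rw [injective_iff_map_eq_zero]
    rintro ⟨f, s, t⟩ h
    have hi : ∀ i, (if h : i ∈ U then 0 else f ⟨i, h⟩) + s * y i + t * z i = 0 :=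
      fun i => congrFun h i
    obtain ⟨rfl, rfl⟩ := hind s t fun i hiU => by
      have := hi i
      rw [dif_pos hiU] at this
      linarith
    have : f = 0 := by
      ext ⟨i, hiU⟩
      have := hi i
      rw [dif_neg hiU] at this
      simpa using this
    simp [this]
  have hker : LinearMap.range q ≤ LinearMap.ker A.mulVecLin := by
    rintro _ ⟨⟨f, s, t⟩, rfl⟩
    rw [LinearMap.mem_ker, Matrix.mulVecLin_apply]
    have : q (f, s, t) = (fun i => if h : i ∈ U then 0 else f ⟨i, h⟩) + s • y + t • z := rfl
    rw [this, Matrix.mulVec_add, Matrix.mulVec_add, Matrix.mulVec_smul, Matrix.mulVec_smul, hy, hz]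
    simp only [smul_zero, add_zero]
    ext i
    refine Finset.sum_eq_zero fun j _ => ?_
    by_cases h : j ∈ U
    · simp [h]
    · have : A i j = 0 := by_contra fun h' => h (hA i j h').2
      simp [this]
  have h1 := Submodule.finrank_mono hker
  rw [LinearMap.finrank_range_of_inj hq] at h1
  have h2 := LinearMap.finrank_range_add_finrank_ker A.mulVecLin
  change A.rank + _ = _ at h2
  simp only [Module.finrank_prod, Module.finrank_fintype_fun_eq_card, Module.finrank_self] at h1 h2
  have h3 := Set.ncard_add_ncard_compl U
  rw [Nat.card_eq_fintype_card] at h3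
  rw [← Nat.card_eq_fintype_card, Nat.card_coe_set_eq] at h1
  omega

/-- If deleting the vertex `u` leaves `U` connected and `u` has two neighbours, then there is a
matrix of nullity two. With `L` the Laplacian of `K - u`, and `g` a solution of `L g = β` for a
vector `β` supported on the neighbours of `u`, take the form `x ↦ (x + x_u g)ᵀ L (x + x_u g)`. -/
theorem hasNullity_two_of_connected_delete {V : Type*} [Fintype V] (K : SimpleGraph V) (U : Set V)
    {u a b : V} (hu : u ∈ U) (hU : ∀ i j, K.Adj i j → i ∈ U)
    (hconn : ∀ x ∈ U, ∀ y ∈ U, x ≠ u → y ≠ u → (K.deleteIncidenceSet u).Reachable x y)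
    (hab : a ≠ b) (ha : K.Adj u a) (hb : K.Adj u b) : HasNullity K U 2 := by
  classical
  set K' := K.deleteIncidenceSet u with hK'
  set L := K'.lapMatrix ℝ with hL
  have hLs : L.IsSymm := K'.isSymm_lapMatrix (R := ℝ)
  have hLoff : ∀ i j, i ≠ j → (L i j ≠ 0 ↔ K.Adj i j ∧ i ≠ u ∧ j ≠ u) := fun i j hij => by
    rw [hL, SimpleGraph.lapMatrix, SimpleGraph.degMatrix, Matrix.sub_apply,
      Matrix.diagonal_apply_ne _ hij, SimpleGraph.adjMatrix_apply,
      ← SimpleGraph.deleteIncidenceSet_adj]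
    by_cases h : K'.Adj i j <;> simp [h, ← hK']
  have hLdiag : ∀ i, L i i ≠ 0 → i ∈ U ∧ i ≠ u := fun i h => by
    rw [hL, SimpleGraph.lapMatrix, SimpleGraph.degMatrix, Matrix.sub_apply,
      Matrix.diagonal_apply_eq, SimpleGraph.adjMatrix_apply, if_neg (K'.irrefl), sub_zero,
      Nat.cast_ne_zero, ← Nat.pos_iff_ne_zero, SimpleGraph.degree_pos_iff_exists_adj] at h
    obtain ⟨j, hj⟩ := h
    rw [hK', SimpleGraph.deleteIncidenceSet_adj] at hj
    exact ⟨hU _ _ hj.1, hj.2.1⟩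
  have hLU : ∀ i j, L i j ≠ 0 → (i ∈ U ∧ i ≠ u) ∧ j ∈ U ∧ j ≠ u := fun i j h => by
    by_cases hij : i = j
    · subst hij
      exact ⟨hLdiag i h, hLdiag i h⟩
    · obtain ⟨h1, h2, h3⟩ := (hLoff i j hij).1 h
      exact ⟨⟨hU _ _ h1, h2⟩, hU _ _ h1.symm, h3⟩
  set d : ℝ := ∑ i, if K.Adj u i then (1 : ℝ) else 0 with hd
  have hd2 : 1 < d := by
    have : (2 : ℝ) ≤ d := by
      have h1 : ∑ i ∈ ({a, b} : Finset V), (if K.Adj u i then (1 : ℝ) else 0) ≤ d :=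
        Finset.sum_le_sum_of_subset_of_nonneg (Finset.subset_univ _)
          fun i _ _ => by split_ifs <;> norm_num
      rw [Finset.sum_pair hab, if_pos ha, if_pos hb] at h1
      linarith
    linarith
  -- The coefficient at `a` makes the entries of `β` sum to zero.
  let β : V → ℝ := fun i => (if K.Adj u i then 1 else 0) - if i = a then d else 0
  have hβ : ∀ i, β i ≠ 0 ↔ K.Adj u i := fun i => by
    by_cases hia : i = a
    · subst hia
      simp only [β, if_pos ha, if_true]
      exact iff_of_true (by linarith) ha
    · by_cases h : K.Adj u i <;> simp [β, hia, h]
  obtain ⟨g, hg⟩ := hLs.exists_mulVec_eq β fun y hy => by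
    rw [hL, SimpleGraph.lapMatrix_mulVec_eq_zero_iff_forall_reachable] at hy
    have h1 : ∀ i, y i * β i = y a * β i := fun i => by
      by_cases h : β i = 0
      · simp [h]
      · have h' := (hβ i).1 h
        rw [hy i a (hconn i (hU _ _ h'.symm) a (hU _ _ ha.symm) h'.ne' ha.ne')]
    simp only [dotProduct, h1, ← Finset.mul_sum]
    simp [β, Finset.sum_sub_distrib, hd]
  have hg' : ∀ i, ∑ k, L i k * g k = β i := fun i => congrFun hg i
  have hg'' : ∀ j, ∑ k, g k * L k j = β j := fun j => by
    rw [← hg' j]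
    exact Finset.sum_congr rfl fun k _ => by rw [hLs.apply k j, mul_comm]
  let T : Matrix V V ℝ := Matrix.of fun i j => (if i = j then 1 else 0) + if j = u then g i else 0
  have hLT : ∀ i j, (L * T) i j = L i j + if j = u then β i else 0 := fun i j => by
    simp only [Matrix.mul_apply, T, Matrix.of_apply, mul_add, Finset.sum_add_distrib]
    congr 1
    · simp
    · by_cases h : j = u <;> simp [h, hg']
  have hA : ∀ i j, (T.transpose * (L * T)) i j = L i j + (if j = u then β i else 0) +
      if i = u then β j + (if j = u then ∑ k, g k * β k else 0) else 0 := fun i j => by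
    rw [Matrix.mul_apply]
    simp only [hLT, Matrix.transpose_apply, T, Matrix.of_apply, add_mul, Finset.sum_add_distrib]
    congr 1
    · simp
    · by_cases h : i = u
      · by_cases h' : j = u <;> simp [h, h', mul_add, Finset.sum_add_distrib, hg'']
      · simp [h]
  have hLu : ∀ i, L i u = 0 := fun i => by_contra fun h => (hLU i u h).2.2 rfl
  have hLu' : ∀ j, L u j = 0 := fun j => by_contra fun h => (hLU u j h).1.2 rfl
  have hβu : β u = 0 := by_contra fun h => K.irrefl ((hβ u).1 h)
  refine ⟨T.transpose * (L * T), ?_, fun i j h => ?_, fun i j hij => ?_, ?_⟩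
  · rw [Matrix.IsSymm, Matrix.transpose_mul, Matrix.transpose_mul, Matrix.transpose_transpose,
      hLs.eq, Matrix.mul_assoc]
  · rw [hA] at h
    by_cases hi : i = u <;> by_cases hj : j = u
    · exact ⟨hi ▸ hu, hj ▸ hu⟩
    · subst hi
      simp only [hLu', hj, if_false, if_true, zero_add, add_zero] at h
      exact ⟨hu, hU _ _ ((hβ j).1 h).symm⟩
    · subst hj
      simp only [hLu, hi, if_false, if_true, zero_add, add_zero] at h
      exact ⟨hU _ _ ((hβ i).1 h).symm, hu⟩
    · simp only [hi, hj, if_false, add_zero] at h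
      exact ⟨(hLU i j h).1.1, (hLU i j h).2.1⟩
  · rw [hA]
    by_cases hi : i = u
    · subst hi
      simp only [hLu', (Ne.symm hij), if_false, if_true, zero_add, add_zero]
      exact hβ j
    · by_cases hj : j = u
      · subst hj
        simp only [hLu, hi, if_false, if_true, zero_add, add_zero]
        rw [hβ, SimpleGraph.adj_comm]
      · simp only [hi, hj, if_false, add_zero]
        rw [hLoff i j hij]
        tauto
  · have h1 : (T.transpose * (L * T)).rank ≤ L.rank :=
      (Matrix.rank_mul_le_right _ _).trans (Matrix.rank_mul_le_left _ _)
    have h2 : L.rank + 2 ≤ U.ncard := by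
      refine Matrix.rank_add_two_le (fun i j h => ⟨(hLU i j h).1.1, (hLU i j h).2.1⟩)
        (y := Pi.single u 1) (z := fun _ => 1) ?_ K'.lapMatrix_mulVec_const_eq_zero fun s t h => ?_
      · ext i
        simp [hLu]
      · have h1 := h u hu
        have h2 := h a (hU _ _ ha.symm)
        simp only [Pi.single_eq_same, mul_one, Pi.single_eq_of_ne ha.ne', mul_zero,
          zero_add] at h1 h2
        exact ⟨by linarith, h2⟩
    omega

/-! ### Cycles -/

theorem IsCycleSubgraph.ncard_edgeSet {V : Type*} {G : SimpleGraph V} {Z : G.Subgraph}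
    (hZ : IsCycleSubgraph Z) : Z.edgeSet.ncard = Z.verts.ncard := by
  classical
  obtain ⟨u, c, hc, rfl⟩ := hZ
  have h1 : c.toSubgraph.edgeSet = (c.edges.toFinset : Set (Sym2 V)) := by
    ext e; simp
  have h2 : c.toSubgraph.verts = (c.support.tail.toFinset : Set V) := by
    ext w
    rw [SimpleGraph.Walk.mem_verts_toSubgraph, List.coe_toFinset, Set.mem_ofPred_eq]
    refine ⟨fun h => ?_, List.mem_of_mem_tail⟩
    rcases (SimpleGraph.Walk.mem_support_iff c).1 h with rfl | h
    · exact SimpleGraph.Walk.end_mem_tail_support hc.not_nil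
    · exact h
  rw [h1, h2, Set.ncard_coe_finset, Set.ncard_coe_finset,
    List.toFinset_card_of_nodup hc.edges_nodup, List.toFinset_card_of_nodup hc.support_nodup]
  simp

/-- Deleting the vertex `u` from a cycle leaves a connected graph. -/
theorem IsCycleSubgraph.reachable_deleteIncidenceSet {V : Type*} {G : SimpleGraph V}
    {Z : G.Subgraph} (hZ : IsCycleSubgraph Z) {u : V} (hu : u ∈ Z.verts) :
    ∀ x ∈ Z.verts, ∀ y ∈ Z.verts, x ≠ u → y ≠ u →
      (Z.spanningCoe.deleteIncidenceSet u).Reachable x y := by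
  classical
  obtain ⟨r, c, hc, rfl⟩ := hZ
  rw [SimpleGraph.Walk.mem_verts_toSubgraph] at hu
  rw [← SimpleGraph.Walk.toSubgraph_rotate c hu]
  replace hc := hc.rotate hu
  generalize c.rotate u hu = c at hc
  cases c with
  | nil => exact absurd hc SimpleGraph.Walk.not_isCycle_nil
  | @cons _ a _ h p =>
    obtain ⟨hp, -⟩ := (SimpleGraph.Walk.cons_isCycle_iff p h).1 hc
    have key : ∀ x ∈ (SimpleGraph.Walk.cons h p).toSubgraph.verts, x ≠ u →
        ((SimpleGraph.Walk.cons h p).toSubgraph.spanningCoe.deleteIncidenceSet u).Reachable a x :=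
        by
      intro x hx hxu
      rw [SimpleGraph.Walk.mem_verts_toSubgraph, SimpleGraph.Walk.support_cons,
        List.mem_cons] at hx
      have hx' := hx.resolve_left hxu
      have hnot := SimpleGraph.Walk.endpoint_notMem_support_takeUntil hp hx' hxu.symm
      refine ⟨(p.takeUntil x hx').transfer _ fun e he => ?_⟩
      induction e with
      | _ s t =>
        rw [SimpleGraph.mem_edgeSet, SimpleGraph.deleteIncidenceSet_adj]
        refine ⟨?_, ?_, ?_⟩
        · rw [SimpleGraph.Subgraph.spanningCoe_adj, ← SimpleGraph.Subgraph.mem_edgeSet,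
            SimpleGraph.Walk.mem_edges_toSubgraph, SimpleGraph.Walk.edges_cons]
          exact List.mem_cons_of_mem _ (SimpleGraph.Walk.edges_takeUntil_subset_edges _ _ he)
        · rintro rfl
          exact hnot (SimpleGraph.Walk.fst_mem_support_of_mem_edges _ he)
        · rintro rfl
          exact hnot (SimpleGraph.Walk.snd_mem_support_of_mem_edges _ he)
    exact fun x hx y hy hxu hyu => (key x hx hxu).symm.trans (key y hy hyu)

theorem IsCycleSubgraph.nonempty {V : Type*} {G : SimpleGraph V} {Z : G.Subgraph}
    (hZ : IsCycleSubgraph Z) : Z.verts.Nonempty := by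
  obtain ⟨u, c, hc, rfl⟩ := hZ
  exact ⟨u, by simp⟩

theorem IsCycleSubgraph.hasNullity_two {V : Type*} [Fintype V] {G : SimpleGraph V}
    {Z : G.Subgraph} (hZ : IsCycleSubgraph Z) : HasNullity Z.spanningCoe Z.verts 2 := by
  obtain ⟨u, hu⟩ := hZ.nonempty
  have h2 : (Z.neighborSet u).ncard = 2 := by
    obtain ⟨r, c, hc, rfl⟩ := hZ
    exact hc.ncard_neighborSet_toSubgraph_eq_two (by simpa using hu)
  obtain ⟨a, b, hab, hab'⟩ := Set.ncard_eq_two.1 h2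
  refine hasNullity_two_of_connected_delete _ _ hu (fun i j h => Z.edge_vert h)
    (hZ.reachable_deleteIncidenceSet hu) hab ?_ ?_
  · exact (Set.ext_iff.1 hab' a).2 (by simp)
  · exact (Set.ext_iff.1 hab' b).2 (by simp)

/-- Deleting `r` edges from a cycle leaves a graph with at least `r` components. -/
theorem IsCycleSubgraph.hasNullity_deleteEdges {V : Type*} [Fintype V] {G : SimpleGraph V}
    {Z : G.Subgraph} (hZ : IsCycleSubgraph Z) {R : Set (Sym2 V)} (hR : R ⊆ Z.edgeSet) :
    HasNullity (Z.spanningCoe.deleteEdges R) Z.verts R.ncard := by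
  refine hasNullity_of_card_edgeSet _ _ _
    (fun i j h => Z.edge_vert (SimpleGraph.deleteEdges_adj.1 h).1) ?_
  rw [SimpleGraph.edgeSet_deleteEdges, SimpleGraph.Subgraph.edgeSet_spanningCoe,
    Set.ncard_sdiff_add_ncard_of_subset hR, hZ.ncard_edgeSet]

/-! ### Nullities of SEAC graphs -/

theorem SEACBuild.hasNullity_two {V : Type*} [Fintype V] {G : SimpleGraph V} {H : G.Subgraph}
    {C : Set G.Subgraph} {E : Set (Sym2 V)} (h : SEACBuild H C E) :
    HasNullity H.spanningCoe H.verts 2 := by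
  induction h with
  | cycle Z hZ => exact hZ.hasNullity_two
  | glue H C E Z u v hH hZ huvH huvZ hverts hnew ih =>
    refine (ih.glue hZ.hasNullity_two (k := 2) ?_).congr ?_ rfl rfl
    · rw [hverts, Set.ncard_pair huvH.ne]
    · ext i j; simp

theorem SEACBuild.subset_edgeSet {V : Type*} {G : SimpleGraph V} {H : G.Subgraph}
    {C : Set G.Subgraph} {E : Set (Sym2 V)} (h : SEACBuild H C E) : E ⊆ H.edgeSet := by
  induction h with
  | cycle Z hZ => simp
  | glue H C E Z u v hH hZ huvH huvZ hverts hnew ih =>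
    rw [SimpleGraph.Subgraph.edgeSet_sup]
    exact Set.insert_subset (Or.inl huvH) (ih.trans Set.subset_union_left)

theorem SEACBuild.le_of_mem {V : Type*} {G : SimpleGraph V} {H : G.Subgraph}
    {C : Set G.Subgraph} {E : Set (Sym2 V)} (h : SEACBuild H C E) : ∀ Z ∈ C, Z ≤ H := by
  induction h with
  | cycle Z hZ => simp
  | glue H C E Z u v hH hZ huvH huvZ hverts hnew ih =>
    rintro W (rfl | hW)
    · exact le_sup_right
    · exact (ih W hW).trans le_sup_left

/-- Two subgraphs meeting in the vertices `u`, `v` only have no other common edge than `uv`. -/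
theorem SimpleGraph.Subgraph.eq_of_mem_edgeSet_of_inter_eq_pair {V : Type*} {G : SimpleGraph V}
    {H Z : G.Subgraph} {u v : V} (hverts : H.verts ∩ Z.verts = {u, v}) {e : Sym2 V}
    (hH : e ∈ H.edgeSet) (hZ : e ∈ Z.edgeSet) : e = s(u, v) := by
  induction e with
  | _ x y =>
    rw [SimpleGraph.Subgraph.mem_edgeSet] at hH hZ
    have hx : x ∈ ({u, v} : Set V) := hverts ▸ ⟨H.edge_vert hH, Z.edge_vert hZ⟩
    have hy : y ∈ ({u, v} : Set V) := hverts ▸ ⟨H.edge_vert hH.symm, Z.edge_vert hZ.symm⟩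
    have hne := hH.ne
    simp only [Set.mem_insert_iff, Set.mem_singleton_iff] at hx hy
    rcases hx with rfl | rfl <;> rcases hy with rfl | rfl
    · exact absurd rfl hne
    · rfl
    · exact Sym2.eq_swap
    · exact absurd rfl hne

/-- An edge lies in at most one constituent cycle, or at most two if it is an edge of
articulation. -/
theorem SEACBuild.cycles_through_edge {V : Type*} {G : SimpleGraph V} {H : G.Subgraph}
    {C : Set G.Subgraph} {E : Set (Sym2 V)} (h : SEACBuild H C E) (e : Sym2 V) :
    (e ∉ E → ∀ Z₁ ∈ C, ∀ Z₂ ∈ C, e ∈ Z₁.edgeSet → e ∈ Z₂.edgeSet → Z₁ = Z₂) ∧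
    (∀ Z₁ ∈ C, ∀ Z₂ ∈ C, ∀ Z₃ ∈ C, e ∈ Z₁.edgeSet → e ∈ Z₂.edgeSet → e ∈ Z₃.edgeSet →
      Z₁ = Z₂ ∨ Z₁ = Z₃ ∨ Z₂ = Z₃) := by
  induction h with
  | cycle Z hZ =>
    refine ⟨?_, ?_⟩
    · rintro - _ rfl _ rfl - -; rfl
    · rintro _ rfl _ rfl _ rfl - - -; exact Or.inl rfl
  | glue H C E Z u v hH hZ huvH huvZ hverts hnew ih =>
    have hold : ∀ W ∈ C, e ∈ W.edgeSet → e ∈ Z.edgeSet → e = s(u, v) := fun W hW heW heZ =>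
      SimpleGraph.Subgraph.eq_of_mem_edgeSet_of_inter_eq_pair hverts
        (SimpleGraph.Subgraph.edgeSet_mono (hH.le_of_mem W hW) heW) heZ
    have hone : e = s(u, v) → ∀ Z₁ ∈ C, ∀ Z₂ ∈ C, e ∈ Z₁.edgeSet → e ∈ Z₂.edgeSet → Z₁ = Z₂ :=
      fun he => ih.1 (he ▸ hnew)
    refine ⟨fun he => ?_, ?_⟩
    · rw [Set.mem_insert_iff, not_or] at he
      rintro Z₁ (rfl | h₁) Z₂ (rfl | h₂) e₁ e₂
      · rfl
      · exact absurd (hold Z₂ h₂ e₂ e₁) he.1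
      · exact absurd (hold Z₁ h₁ e₁ e₂) he.1
      · exact ih.1 he.2 Z₁ h₁ Z₂ h₂ e₁ e₂
    · rintro Z₁ (rfl | h₁) Z₂ (rfl | h₂) Z₃ (rfl | h₃) e₁ e₂ e₃
      · exact Or.inl rfl
      · exact Or.inl rfl
      · exact Or.inr (Or.inl rfl)
      · exact Or.inr (Or.inr (hone (hold Z₂ h₂ e₂ e₁) Z₂ h₂ Z₃ h₃ e₂ e₃))
      · exact Or.inr (Or.inr rfl)
      · exact Or.inr (Or.inl (hone (hold Z₁ h₁ e₁ e₂) Z₁ h₁ Z₃ h₃ e₁ e₃))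
      · exact Or.inl (hone (hold Z₁ h₁ e₁ e₃) Z₁ h₁ Z₂ h₂ e₁ e₂)
      · exact ih.2 Z₁ h₁ Z₂ h₂ Z₃ h₃ e₁ e₂ e₃

/-- A constituent cycle has at most as many neighbors as edges of articulation. -/
theorem SEACBuild.ncard_cycleNeighbors_le {V : Type*} [Finite V] {G : SimpleGraph V}
    {H : G.Subgraph} {C : Set G.Subgraph} {E : Set (Sym2 V)} (h : SEACBuild H C E)
    {Z : G.Subgraph} (hZ : Z ∈ C) : (cycleNeighbors C E Z).ncard ≤ (E ∩ Z.edgeSet).ncard := by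
  classical
  rcases (cycleNeighbors C E Z).eq_empty_or_nonempty with h0 | ⟨W₀, hW₀⟩
  · simp [h0]
  have : Nonempty (Sym2 V) := ⟨hW₀.2.2.choose⟩
  choose! f hf using fun (W : G.Subgraph) (hW : W ∈ cycleNeighbors C E Z) => hW.2.2
  refine Set.ncard_le_ncard_of_injOn f (fun W hW => ⟨(hf W hW).1, (hf W hW).2.1⟩) ?_
    (Set.toFinite _)
  intro W₁ h₁ W₂ h₂ h12
  have h2' := (hf W₂ h₂).2.2
  rw [← h12] at h2'
  rcases (h.cycles_through_edge (f W₁)).2 Z hZ W₁ h₁.1 W₂ h₂.1 (hf W₁ h₁).2.1 (hf W₁ h₁).2.2 h2'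
    with h' | h' | h'
  · exact absurd h'.symm h₁.2.1
  · exact absurd h'.symm h₂.2.1
  · exact h'

/-- After deletion of a set `R` of edges of the constituent cycle `Z`, none of them an edge of
articulation, the nullity can be as large as the number of edges of `Z` that lie in `R` or are
edges of articulation: what is attached to `Z` at an edge of articulation makes up for that edge,
so that the nullity is that of the disjoint paths left of `Z`. -/
theorem SEACBuild.hasNullity_deleteEdges {V : Type*} [Fintype V] {G : SimpleGraph V}
    {H : G.Subgraph} {C : Set G.Subgraph} {E : Set (Sym2 V)} (h : SEACBuild H C E) :
    ∀ Z ∈ C, ∀ R ⊆ Z.edgeSet, Disjoint R E →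
      HasNullity (H.spanningCoe.deleteEdges R) H.verts ((E ∩ Z.edgeSet).ncard + R.ncard) := by
  induction h with
  | cycle Z hZ =>
    rintro _ rfl R hR -
    simpa using hZ.hasNullity_deleteEdges hR
  | glue H C E Z' u v hH hZ' huvH huvZ' hverts hnew ih =>
    have hcap : (H.verts ∩ Z'.verts).ncard = 2 := by rw [hverts, Set.ncard_pair huvH.ne]
    have hboth : ∀ e, e ∈ H.edgeSet → e ∈ Z'.edgeSet → e = s(u, v) := fun e =>
      SimpleGraph.Subgraph.eq_of_mem_edgeSet_of_inter_eq_pair hverts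
    rintro Z (rfl | hZ) R hR hRE
    · have huvR : s(u, v) ∉ R := fun h' => Set.disjoint_left.1 hRE h' (Set.mem_insert _ _)
      have h1 := hZ'.hasNullity_deleteEdges (R := insert s(u, v) R)
        (Set.insert_subset huvZ' hR)
      rw [Set.ncard_insert_of_notMem huvR (Set.toFinite _)] at h1
      refine (hH.hasNullity_two.glue h1 (k := 1 + R.ncard) (by omega)).congr ?_ rfl ?_
      · ext i j
        have := hboth s(i, j)
        have huv : s(i, j) = s(u, v) → H.Adj i j := fun h' => by
          rw [← SimpleGraph.Subgraph.mem_edgeSet, h']; exact huvH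
        simp only [SimpleGraph.Subgraph.mem_edgeSet] at this
        simp only [SimpleGraph.sup_adj, SimpleGraph.deleteEdges_adj,
          SimpleGraph.Subgraph.spanningCoe_adj, SimpleGraph.Subgraph.sup_adj,
          Set.mem_insert_iff, not_or]
        have hR' : s(i, j) ∈ R → Z.Adj i j := fun h' => hR h'
        have hR'' : s(i, j) ∈ R → s(i, j) ≠ s(u, v) := fun h' h'' => huvR (h'' ▸ h')
        tauto
      · have : insert s(u, v) E ∩ Z.edgeSet = {s(u, v)} := by
          ext e
          simp only [Set.mem_inter_iff, Set.mem_insert_iff, Set.mem_singleton_iff]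
          constructor
          · rintro ⟨h' | h', h''⟩
            · exact h'
            · exact hboth e (hH.subset_edgeSet h') h''
          · rintro rfl
            exact ⟨Or.inl rfl, huvZ'⟩
        rw [this, Set.ncard_singleton]
    · have hRH : R ⊆ H.edgeSet :=
        hR.trans (SimpleGraph.Subgraph.edgeSet_mono (hH.le_of_mem Z hZ))
      have huvR : s(u, v) ∉ R := fun h' => Set.disjoint_left.1 hRE h' (Set.mem_insert _ _)
      have hRE' : Disjoint R E := hRE.mono_right (Set.subset_insert _ _)
      have hgraph : ∀ R', R ⊆ R' → R' ⊆ insert s(u, v) R →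
          H.spanningCoe.deleteEdges R' ⊔ Z'.spanningCoe =
            (H ⊔ Z').spanningCoe.deleteEdges R := fun R' h1 h2 => by
        ext i j
        have := hboth s(i, j)
        have huv : s(i, j) = s(u, v) → Z'.Adj i j := fun h' => by
          rw [← SimpleGraph.Subgraph.mem_edgeSet, h']; exact huvZ'
        have h3 := @h1 s(i, j)
        have h4 := @h2 s(i, j)
        have h5 := @hRH s(i, j)
        have h6 : s(i, j) ∈ R → s(i, j) ≠ s(u, v) := fun h' h'' => huvR (h'' ▸ h')
        simp only [SimpleGraph.Subgraph.mem_edgeSet, Set.mem_insert_iff] at this h3 h4 h5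
        simp only [SimpleGraph.sup_adj, SimpleGraph.deleteEdges_adj,
          SimpleGraph.Subgraph.spanningCoe_adj, SimpleGraph.Subgraph.sup_adj]
        tauto
      by_cases huvZ : s(u, v) ∈ Z.edgeSet
      · have h1 := ih Z hZ (insert s(u, v) R) (Set.insert_subset huvZ hR)
          (Set.disjoint_insert_left.2 ⟨hnew, hRE'⟩)
        rw [Set.ncard_insert_of_notMem huvR (Set.toFinite _)] at h1
        refine (h1.glue hZ'.hasNullity_two (k := (E ∩ Z.edgeSet).ncard + (R.ncard + 1))
          (by omega)).congr (hgraph _ (Set.subset_insert _ _) subset_rfl) rfl ?_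
        rw [Set.insert_inter_of_mem huvZ, Set.ncard_insert_of_notMem (fun h' => hnew h'.1)
          (Set.toFinite _)]
        omega
      · refine ((ih Z hZ R hR hRE').glue hZ'.hasNullity_two
          (k := (E ∩ Z.edgeSet).ncard + R.ncard) (by omega)).congr
          (hgraph _ subset_rfl (Set.subset_insert _ _)) rfl ?_
        rw [Set.insert_inter_of_notMem huvZ]

theorem IsSEACConstruction.ncard_cycleNeighbors_le_maxMult {V : Type*} [Fintype V]
    {G : SimpleGraph V} {C : Set G.Subgraph} {E : Set (Sym2 V)} (h : IsSEACConstruction G C E)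
    {Z : G.Subgraph} (hZ : Z ∈ C) : (cycleNeighbors C E Z).ncard ≤ maxMult G := by
  refine (SEACBuild.ncard_cycleNeighbors_le h hZ).trans ?_
  have := SEACBuild.hasNullity_deleteEdges h Z hZ ∅ (Set.empty_subset _) (Set.empty_disjoint _)
  refine HasNullity.le_maxMult (this.congr ?_ rfl (by simp))
  simp

/-! ### Transversality and the Strong Arnold Property -/

/-- An orthonormal basis of the kernel of `A`, as the columns of a matrix. -/
theorem Matrix.exists_orthonormal_ker {V : Type*} [Fintype V] (A : Matrix V V ℝ) :
    ∃ N : Matrix V (Fin (Module.finrank ℝ (LinearMap.ker A.mulVecLin))) ℝ,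
      A * N = 0 ∧ N.transpose * N = 1 ∧
      ∀ x, A.mulVec x = 0 → N.mulVec (N.transpose.mulVec x) = x := by
  classical
  let e := WithLp.linearEquiv 2 ℝ (V → ℝ)
  let K : Submodule ℝ (EuclideanSpace ℝ V) := (LinearMap.ker A.mulVecLin).comap e.toLinearMap
  have hK : Module.finrank ℝ K = Module.finrank ℝ (LinearMap.ker A.mulVecLin) := by
    have h : K = (LinearMap.ker A.mulVecLin).map e.symm.toLinearMap :=
      (Submodule.map_equiv_eq_comap_symm e.symm _).symm
    rw [h]
    exact LinearEquiv.finrank_map_eq e.symm _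
  generalize Module.finrank ℝ (LinearMap.ker A.mulVecLin) = k at hK
  let b := (stdOrthonormalBasis ℝ K).reindex (finCongr hK)
  clear_value b
  refine ⟨Matrix.of fun i j => (b j : EuclideanSpace ℝ V) i, ?_, ?_, ?_⟩
  · ext i j
    have : A.mulVec (e (b j)) = 0 := (b j).2
    exact congrFun this i
  · ext i j
    have h := orthonormal_iff_ite.1 b.orthonormal i j
    rw [Submodule.coe_inner, PiLp.inner_apply] at h
    rw [Matrix.mul_apply, Matrix.one_apply, ← h]
    refine Finset.sum_congr rfl fun k _ => ?_
    simp [mul_comm]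
  · intro x hx
    let y : K := ⟨e.symm x, show A.mulVec (e (e.symm x)) = 0 by rwa [e.apply_symm_apply]⟩
    have h : ∑ j, inner ℝ (b j) y • e (b j : EuclideanSpace ℝ V) = x := by
      have h := congrArg (fun z : K => e (z : EuclideanSpace ℝ V)) (b.sum_repr' y)
      simp only [Submodule.coe_sum, Submodule.coe_smul, map_sum, map_smul] at h
      exact h.trans (e.apply_symm_apply x)
    refine Eq.trans ?_ h
    ext i
    simp only [Matrix.mulVec, dotProduct, Matrix.of_apply, Matrix.transpose_apply,
      Finset.sum_apply]
    refine Finset.sum_congr rfl fun j _ => ?_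
    rw [Pi.smul_apply, smul_eq_mul, mul_comm, Submodule.coe_inner, PiLp.inner_apply]
    congr 1
    refine Finset.sum_congr rfl fun k _ => ?_
    simp [y, e, mul_comm]

open Topology in
/-- A quadratic map with surjective linear part is open at the origin. -/
theorem map_nhds_zero_of_surjective_linear_part {E F : Type*} [NormedAddCommGroup E]
    [NormedSpace ℝ E] [FiniteDimensional ℝ E] [NormedAddCommGroup F] [NormedSpace ℝ F]
    [FiniteDimensional ℝ F] (L : E →ₗ[ℝ] F) (B : E →ₗ[ℝ] E →ₗ[ℝ] F)
    (hL : Function.Surjective L) : Filter.map (fun x => L x + B x x) (𝓝 0) = 𝓝 0 := by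
  have : CompleteSpace E := FiniteDimensional.complete ℝ E
  have : CompleteSpace F := FiniteDimensional.complete ℝ F
  let L' : E →L[ℝ] F := L.toContinuousLinearMap
  let B' : E →L[ℝ] E →L[ℝ] F := LinearMap.toContinuousLinearMap
    ((LinearMap.toContinuousLinearMap : (E →ₗ[ℝ] F) ≃ₗ[ℝ] (E →L[ℝ] F)).toLinearMap ∘ₗ B)
  have h1 : HasStrictFDerivAt (fun x => L' x + B' x x) L' 0 := by
    have h2 := B'.hasStrictFDerivAt_of_bilinear (hasStrictFDerivAt_id (0 : E))
      (hasStrictFDerivAt_id (0 : E))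
    refine (L'.hasStrictFDerivAt.add h2).congr_fderiv ?_
    ext x
    simp
  have h3 := h1.map_nhds_eq_of_surj (LinearMap.range_eq_top.2 hL)
  simpa [L', B'] using h3

open scoped Matrix.Norms.Elementwise in
open Matrix Topology in
/-- **Transversality.** Let `A` be a symmetric matrix whose nonzero off-diagonal entries lie on
edges of `G`, and suppose `A` has the Strong Arnold Property: the only symmetric `X` with `A X = 0`
which vanishes on the diagonal and wherever `A` does not vanish is `X = 0`. Then some matrix of
`S(G)` has at least the nullity of `A`, here the number of columns of a matrix `N` which form an
orthonormal basis of the kernel.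

The perturbed matrix `A + D` and the perturbed basis
`N + A Z` are sought with `(A + D) (N + A Z) + N (W - Wᵀ) = 0`. The Strong Arnold Property makes the
linear part surjective even for `D` with the pattern of `A`, so a solution exists for which `D` has
a prescribed small nonzero value on the missing edges. As `(N + A Z)ᵀ N = 1`, the matrix `W - Wᵀ` is
symmetric, hence zero. -/
theorem card_le_maxMult_of_strongArnold {V : Type*} [Fintype V] {G : SimpleGraph V}
    {A : Matrix V V ℝ} (hA : A.IsSymm) (hAG : ∀ i j, i ≠ j → A i j ≠ 0 → G.Adj i j)
    (hSAP : ∀ X : Matrix V V ℝ, X.IsSymm → A * X = 0 → (∀ i, X i i = 0) →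
      (∀ i j, A i j ≠ 0 → X i j = 0) → X = 0)
    {κ : Type*} [Fintype κ] [DecidableEq κ] (N : Matrix V κ ℝ) (hAN : A * N = 0)
    (hNN : N.transpose * N = 1) (hN : ∀ x, A.mulVec x = 0 → N.mulVec (N.transpose.mulVec x) = x) :
    Fintype.card κ ≤ maxMult G := by
  classical
  let m : V → V → ℝ := fun i j => if i = j ∨ A i j ≠ 0 then 1 else 0
  have hm : ∀ i j, m i j = m j i := fun i j => by
    simp only [m, hA.apply i j, eq_comm]
  let E₀ : Matrix V V ℝ := Matrix.of fun i j => if G.Adj i j ∧ A i j = 0 then 1 else 0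
  let D : (Matrix V V ℝ × Matrix V κ ℝ × Matrix κ κ ℝ × ℝ) →ₗ[ℝ] Matrix V V ℝ :=
    { toFun := fun x => Matrix.of (fun i j => m i j * (x.1 i j + x.1 j i)) + x.2.2.2 • E₀
      map_add' := fun x y => by
        ext i j; simp; ring
      map_smul' := fun c x => by
        ext i j; simp; ring }
  let L₁ : (Matrix V V ℝ × Matrix V κ ℝ × Matrix κ κ ℝ × ℝ) →ₗ[ℝ] Matrix V κ ℝ :=
    { toFun := fun x => D x * N + A * (A * x.2.1) + N * (x.2.2.1 - x.2.2.1.transpose)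
      map_add' := fun x y => by
        simp only [map_add, Prod.fst_add, Prod.snd_add, Matrix.add_mul, Matrix.mul_add,
          Matrix.transpose_add, Matrix.mul_sub]
        abel
      map_smul' := fun c x => by
        simp only [map_smul, Prod.smul_fst, Prod.smul_snd, Matrix.smul_mul, Matrix.mul_smul,
          Matrix.transpose_smul, Matrix.mul_sub, RingHom.id_apply, smul_add, smul_sub] }
  let L : (Matrix V V ℝ × Matrix V κ ℝ × Matrix κ κ ℝ × ℝ) →ₗ[ℝ] Matrix V κ ℝ × ℝ :=
    L₁.prod (LinearMap.snd ℝ _ _ ∘ₗ LinearMap.snd ℝ _ _ ∘ₗ LinearMap.snd ℝ _ _)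
  let B : (Matrix V V ℝ × Matrix V κ ℝ × Matrix κ κ ℝ × ℝ) →ₗ[ℝ]
      (Matrix V V ℝ × Matrix V κ ℝ × Matrix κ κ ℝ × ℝ) →ₗ[ℝ] Matrix V κ ℝ × ℝ :=
    LinearMap.mk₂ ℝ (fun x y => (D x * (A * y.2.1), 0))
      (fun x x' y => by simp [Matrix.add_mul]) (fun c x y => by simp)
      (fun x y y' => by simp [Matrix.mul_add]) (fun c x y => by simp)
  -- It suffices to vary `p`, `Z` and `W`, leaving the entries on the missing edges alone.
  have hL₁ : ∀ Y : Matrix V κ ℝ, ∃ p Z W, L₁ (p, Z, W, 0) = Y := by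
    let J : (Matrix V V ℝ × Matrix V κ ℝ × Matrix κ κ ℝ) →ₗ[ℝ]
        (Matrix V V ℝ × Matrix V κ ℝ × Matrix κ κ ℝ × ℝ) :=
      { toFun := fun x => (x.1, x.2.1, x.2.2, 0)
        map_add' := fun x y => by simp
        map_smul' := fun c x => by simp }
    suffices h : LinearMap.range (L₁ ∘ₗ J) = ⊤ by
      intro Y
      obtain ⟨⟨p, Z, W⟩, h⟩ := LinearMap.range_eq_top.1 h Y
      exact ⟨p, Z, W, h⟩
    by_contra hne
    obtain ⟨φ, hφ, hφ0⟩ := Submodule.exists_le_ker_of_lt_top _ (lt_top_iff_ne_top.2 hne)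
    -- The functional is `Y ↦ tr (Qᵀ Y)`.
    let Q : Matrix V κ ℝ := Matrix.of fun i j => φ (Matrix.single i j 1)
    have hQ : ∀ Y, φ Y = ∑ i, ∑ j, Q i j * Y i j := fun Y => by
      conv_lhs => rw [Matrix.matrix_eq_sum_single Y]
      rw [map_sum]
      refine Finset.sum_congr rfl fun i _ => ?_
      rw [map_sum]
      refine Finset.sum_congr rfl fun j _ => ?_
      rw [show Matrix.single i j (Y i j) = Y i j • Matrix.single i j (1 : ℝ) by simp, map_smul,
        smul_eq_mul, mul_comm]
      rfl
    have hQtr : ∀ Y, φ Y = (Q.transpose * Y).trace := fun Y => by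
      rw [hQ, Finset.sum_comm, Matrix.trace]
      rfl
    have hann : ∀ p Z W, (Q.transpose * L₁ (p, Z, W, 0)).trace = 0 := fun p Z W => by
      rw [← hQtr]
      exact hφ0 ⟨(p, Z, W), rfl⟩
    -- Varying `Z`, the columns of `Q` lie in the kernel of `A`.
    have hAQ : A * Q = 0 := by
      have h1 : Q.transpose * A * A = 0 := Matrix.ext_iff_trace_mul_right.2 fun Z => by
        have := hann 0 Z 0
        simp only [L₁, LinearMap.coe_mk, AddHom.coe_mk] at this
        rw [show D (0, Z, 0, 0) = 0 by ext i j; simp [D]] at this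
        simpa [Matrix.mul_assoc] using this
      have h2 : (A * Q).transpose * (A * Q) = 0 := by
        rw [Matrix.transpose_mul, hA.eq, ← Matrix.mul_assoc, h1, Matrix.zero_mul]
      simpa [Matrix.conjTranspose_eq_transpose_of_trivial] using
        (Matrix.conjTranspose_mul_self_eq_zero (A := A * Q)).1
          (by rwa [Matrix.conjTranspose_eq_transpose_of_trivial])
    have hNQ : N * (N.transpose * Q) = Q := by
      ext i j
      have h1 := congrFun (hN (Q.col j) (funext fun i => congrFun (congrFun hAQ i) j)) i
      rw [Matrix.mulVec_mulVec] at h1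
      rw [← Matrix.mul_assoc]
      exact h1
    -- Varying `W`, the matrix `Nᵀ Q` is symmetric.
    have hsymm : (N.transpose * Q).IsSymm := by
      have h1 : Q.transpose * N - N.transpose * Q = 0 :=
        Matrix.ext_iff_trace_mul_right.2 fun W => by
          have := hann 0 0 W
          simp only [L₁, LinearMap.coe_mk, AddHom.coe_mk] at this
          rw [show D (0, 0, W, 0) = 0 by ext i j; simp [D]] at this
          simp only [Matrix.zero_mul, Matrix.mul_zero, add_zero, zero_add, Matrix.mul_sub,
            Matrix.trace_sub] at this
          rw [← Matrix.mul_assoc, ← Matrix.mul_assoc,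
            ← Matrix.trace_transpose (Q.transpose * N * W.transpose), Matrix.transpose_mul,
            Matrix.transpose_transpose, Matrix.transpose_mul, Matrix.transpose_transpose,
            Matrix.trace_mul_comm W] at this
          rw [Matrix.sub_mul, Matrix.trace_sub, this]
          simp
      rw [Matrix.IsSymm, Matrix.transpose_mul, Matrix.transpose_transpose]
      exact sub_eq_zero.1 h1
    -- Varying `p`, the matrix `Q Nᵀ` is one of those excluded by the Strong Arnold Property.
    have hX : Q * N.transpose = 0 := by
      have hXs : (Q * N.transpose).IsSymm := by
        rw [← hNQ, Matrix.IsSymm, Matrix.transpose_mul, Matrix.transpose_mul, hsymm.eq,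
          Matrix.transpose_transpose, ← Matrix.mul_assoc]
      have hXm : ∀ i j, m i j * (Q * N.transpose) i j = 0 := fun i j => by
        have := hann (Matrix.single i j 1) 0 0
        simp only [L₁, LinearMap.coe_mk, AddHom.coe_mk, Matrix.mul_zero, add_zero,
          Matrix.transpose_zero, sub_zero] at this
        rw [← Matrix.mul_assoc, Matrix.trace_mul_comm, ← Matrix.mul_assoc,
          show N * Q.transpose = Q * N.transpose by
            rw [← hXs.eq, Matrix.transpose_mul, Matrix.transpose_transpose]] at this
        have hD : D (Matrix.single i j 1, 0, 0, 0) =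
            m i j • (Matrix.single i j 1 + Matrix.single j i 1) := by
          ext s t
          simp only [D, LinearMap.coe_mk, AddHom.coe_mk, zero_smul, Matrix.of_apply,
            Matrix.smul_apply, Matrix.add_apply, smul_eq_mul, Matrix.single_apply]
          by_cases h1 : i = s ∧ j = t
          · obtain ⟨rfl, rfl⟩ := h1
            simp [and_comm]
          · by_cases h2 : j = s ∧ i = t
            · obtain ⟨rfl, rfl⟩ := h2
              simp [hm]
            · rw [if_neg h1, if_neg h2, if_neg fun h => h2 h.symm]
              simp
        rw [hD, Matrix.mul_smul, Matrix.mul_add, Matrix.trace_smul, Matrix.trace_add,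
          Matrix.trace_mul_single, Matrix.trace_mul_single, hXs.apply] at this
        simp only [smul_eq_mul] at this
        simp only [MulOpposite.op_one, one_smul] at this
        linarith
      refine hSAP _ hXs (by rw [← Matrix.mul_assoc, hAQ, Matrix.zero_mul])
        (fun i => by simpa [m] using hXm i i) fun i j hij => by simpa [m, hij] using hXm i j
    have hQ0 : Q = 0 := by
      rw [← Matrix.mul_one Q, ← hNN, ← Matrix.mul_assoc, hX, Matrix.zero_mul]
    refine hφ (LinearMap.ext fun Y => ?_)
    rw [hQ, hQ0]
    simp
  have hL : Function.Surjective L := by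
    rintro ⟨Y, ε⟩
    obtain ⟨p, Z, W, h⟩ := hL₁ (Y - L₁ (0, 0, 0, ε))
    refine ⟨(p, Z, W, 0) + (0, 0, 0, ε), ?_⟩
    rw [map_add]
    ext1
    · change L₁ _ + L₁ _ = Y
      rw [h]; abel
    · change (0 : ℝ) + ε = ε
      simp
  have hopen : Filter.map (fun x => L x + B x x)
      (𝓝 (0 : Matrix V V ℝ × Matrix V κ ℝ × Matrix κ κ ℝ × ℝ)) =
      𝓝 (0 : Matrix V κ ℝ × ℝ) := map_nhds_zero_of_surjective_linear_part L B hL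
  have hS : ∀ᶠ x in 𝓝 (0 : Matrix V V ℝ × Matrix V κ ℝ × Matrix κ κ ℝ × ℝ),
      ∀ i j, A i j ≠ 0 → A i j + D x i j ≠ 0 := by
    rw [Filter.eventually_all]; intro i
    rw [Filter.eventually_all]; intro j
    by_cases h : A i j = 0
    · simp [h]
    · have hc : Continuous fun x => A i j + D x i j := by
        have hD : Continuous D := D.continuous_of_finiteDimensional
        exact continuous_const.add (hD.matrix_elem i j)
      refine (hc.continuousAt.eventually_ne ?_).mono fun x hx _ => hx
      simpa using h
  have himg : ∀ᶠ y in 𝓝 (0 : Matrix V κ ℝ × ℝ), ∃ x, (∀ i j, A i j ≠ 0 → A i j + D x i j ≠ 0) ∧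
      L x + B x x = y := by
    have h : ∀ᶠ y in Filter.map (fun x => L x + B x x)
        (𝓝 (0 : Matrix V V ℝ × Matrix V κ ℝ × Matrix κ κ ℝ × ℝ)),
        ∃ x, (∀ i j, A i j ≠ 0 → A i j + D x i j ≠ 0) ∧ L x + B x x = y :=
      Filter.eventually_map.2 (hS.mono fun x hx => ⟨x, hx, rfl⟩)
    rwa [hopen] at h
  obtain ⟨ε, ⟨⟨p, Z, W, ε'⟩, hx, hxε⟩, hε⟩ : ∃ ε : ℝ, (∃ x,
      (∀ i j, A i j ≠ 0 → A i j + D x i j ≠ 0) ∧ L x + B x x = (0, ε)) ∧ ε ≠ 0 := by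
    have hc : Filter.Tendsto (fun ε : ℝ => ((0 : Matrix V κ ℝ), ε)) (𝓝[≠] 0) (𝓝 0) :=
      ((Continuous.prodMk_right (0 : Matrix V κ ℝ)).tendsto 0).mono_left nhdsWithin_le_nhds
    exact ((hc.eventually himg).and self_mem_nhdsWithin).exists
  obtain ⟨h1, h2⟩ := Prod.mk_inj.1 hxε
  change ε' + 0 = ε at h2
  rw [add_zero] at h2
  subst h2
  set d := D (p, Z, W, ε') with hd
  change d * N + A * (A * Z) + N * (W - W.transpose) + d * (A * Z) = 0 at h1
  have hdij : ∀ i j, d i j = m i j * (p i j + p j i) + ε' * E₀ i j := fun i j => rfl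
  have hds : d.IsSymm := by
    ext i j
    rw [Matrix.transpose_apply, hdij, hdij, hm, add_comm (p i j)]
    simp only [E₀, Matrix.of_apply, G.adj_comm, hA.apply i j]
  have hYN : (N + A * Z).transpose * N = 1 := by
    rw [Matrix.transpose_add, Matrix.transpose_mul, hA.eq, Matrix.add_mul, hNN, Matrix.mul_assoc,
      hAN, Matrix.mul_zero, add_zero]
  have h3 : (A + d) * (N + A * Z) + N * (W - W.transpose) = 0 := by
    rw [← h1, Matrix.add_mul, Matrix.mul_add, Matrix.mul_add, hAN]
    abel
  have hW : W - W.transpose = 0 := by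
    have h4 : (N + A * Z).transpose * ((A + d) * (N + A * Z)) + (W - W.transpose) = 0 := by
      have h5 := congrArg (fun M => (N + A * Z).transpose * M) h3
      simpa only [Matrix.mul_add, ← Matrix.mul_assoc _ N, hYN, Matrix.one_mul,
        Matrix.mul_zero] using h5
    have h6 : (W - W.transpose).transpose = W - W.transpose := by
      rw [eq_neg_of_add_eq_zero_right h4, Matrix.transpose_neg, Matrix.transpose_mul,
        Matrix.transpose_mul, Matrix.transpose_transpose, (hA.add hds).eq, Matrix.mul_assoc]
    have h7 : (W - W.transpose).transpose = -(W - W.transpose) := by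
      rw [Matrix.transpose_sub, Matrix.transpose_transpose, neg_sub]
    ext i j
    have h8 := congrFun (congrFun (h6.symm.trans h7) i) j
    rw [Matrix.neg_apply] at h8
    rw [Matrix.zero_apply]
    linarith
  rw [hW, Matrix.mul_zero, add_zero] at h3
  have hmem : A + d ∈ symMatricesOf G := by
    refine ⟨hA.add hds, fun i j hij => ?_⟩
    by_cases h : A i j = 0
    · rw [Matrix.add_apply, h, hdij]
      by_cases hG : G.Adj i j <;> simp [m, E₀, h, hij, hG, hε]
    · exact iff_of_true (hx i j h) (hAG i j hij h)
  refine le_trans ?_ (finrank_ker_le_maxMult hmem)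
  let T : (κ → ℝ) →ₗ[ℝ] LinearMap.ker (A + d).mulVecLin :=
    (N + A * Z).mulVecLin.codRestrict _ fun y => by
      rw [LinearMap.mem_ker, Matrix.mulVecLin_apply, Matrix.mulVecLin_apply, Matrix.mulVec_mulVec,
        h3, Matrix.zero_mulVec]
  have hT : Function.Injective T := by
    rw [injective_iff_map_eq_zero]
    intro y hy
    have h8 : (N + A * Z).mulVec y = 0 := congrArg Subtype.val hy
    have h9 : N.transpose * (N + A * Z) = 1 := by
      rw [← Matrix.transpose_transpose (N + A * Z), ← Matrix.transpose_mul, hYN,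
        Matrix.transpose_one]
    rw [← Matrix.one_mulVec y, ← h9, ← Matrix.mulVec_mulVec, h8, Matrix.mulVec_zero]
  have h10 := LinearMap.finrank_le_finrank_of_injective hT
  rwa [Module.finrank_fintype_fun_eq_card] at h10

/-- A matrix with the Strong Arnold Property bounds `M(G)` by its nullity, even if some edges of
`G` are missing from its pattern. -/
theorem finrank_ker_le_maxMult_of_strongArnold {V : Type*} [Fintype V] {G : SimpleGraph V}
    {A : Matrix V V ℝ} (hA : A.IsSymm) (hAG : ∀ i j, i ≠ j → A i j ≠ 0 → G.Adj i j)
    (hSAP : ∀ X : Matrix V V ℝ, X.IsSymm → A * X = 0 → (∀ i, X i i = 0) →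
      (∀ i j, A i j ≠ 0 → X i j = 0) → X = 0) :
    Module.finrank ℝ (LinearMap.ker A.mulVecLin) ≤ maxMult G := by
  obtain ⟨N, hAN, hNN, hN⟩ := A.exists_orthonormal_ker
  simpa using card_le_maxMult_of_strongArnold hA hAG hSAP N hAN hNN hN

/-! ### `K₄` and subdivisions of `K₂,₃` -/

theorem Matrix.three_le_finrank_ker {V : Type*} [Fintype V] {A : Matrix V V ℝ}
    (y : Fin 3 → V → ℝ) (hy : ∀ i, A.mulVec (y i) = 0)
    (hind : ∀ c : Fin 3 → ℝ, (∀ p, ∑ i, c i * y i p = 0) → ∀ i, c i = 0) :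
    3 ≤ Module.finrank ℝ (LinearMap.ker A.mulVecLin) := by
  let z : Fin 3 → LinearMap.ker A.mulVecLin := fun i => ⟨y i, hy i⟩
  have hz : LinearIndependent ℝ z := by
    rw [Fintype.linearIndependent_iff]
    intro c hc
    refine hind c fun p => ?_
    have := congrFun (congrArg Subtype.val hc) p
    simpa [z] using this
  simpa using hz.fintype_card_le_finrank

/-- On a complete graph with four vertices, the all-ones matrix has nullity three and the Strong
Arnold Property. -/
theorem three_le_maxMult_of_complete_four {V : Type*} [Fintype V] {G : SimpleGraph V}
    {a b c d : V} (hab : G.Adj a b) (hac : G.Adj a c) (had : G.Adj a d) (hbc : G.Adj b c)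
    (hbd : G.Adj b d) (hcd : G.Adj c d) : 3 ≤ maxMult G := by
  classical
  let S : Finset V := {a, b, c, d}
  have hS : ∀ x ∈ S, ∀ y ∈ S, x ≠ y → G.Adj x y := by
    intro x hx y hy hxy
    simp only [S, Finset.mem_insert, Finset.mem_singleton] at hx hy
    rcases hx with rfl | rfl | rfl | rfl <;> rcases hy with rfl | rfl | rfl | rfl <;>
      first | exact absurd rfl hxy | assumption | (apply SimpleGraph.Adj.symm; assumption)
  let A : Matrix V V ℝ := Matrix.of fun i j => if (i ∈ S ∧ j ∈ S) ∨ i = j then 1 else 0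
  have hmul : ∀ (x : V → ℝ) i, A.mulVec x i = if i ∈ S then ∑ j ∈ S, x j else x i := by
    intro x i
    by_cases hi : i ∈ S
    · rw [if_pos hi, Matrix.mulVec, dotProduct, ← Finset.sum_subset (Finset.subset_univ S)]
      · exact Finset.sum_congr rfl fun j hj => by simp [A, hi, hj]
      · intro j _ hj
        have : i ≠ j := fun h => hj (h ▸ hi)
        simp [A, hj, this]
    · simp [Matrix.mulVec, dotProduct, A, hi]
  have hsum : ∀ x : V → ℝ, ∑ j ∈ S, x j = x a + (x b + (x c + x d)) := fun x => by
    rw [Finset.sum_insert (by simp [hab.ne, hac.ne, had.ne]),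
      Finset.sum_insert (by simp [hbc.ne, hbd.ne]), Finset.sum_pair hcd.ne]
  refine le_trans ?_ (finrank_ker_le_maxMult_of_strongArnold (A := A) ?_ ?_ ?_)
  · refine Matrix.three_le_finrank_ker
      ![Pi.single a 1 - Pi.single b 1, Pi.single a 1 - Pi.single c 1,
        Pi.single a 1 - Pi.single d 1] ?_ ?_
    · intro k
      ext i
      rw [hmul, hsum]
      by_cases hi : i ∈ S
      · fin_cases k <;> simp [hi, hab.ne, hac.ne, had.ne, hbc.ne, hbd.ne, hcd.ne, hab.ne',
          hac.ne', had.ne', hbc.ne', hbd.ne', hcd.ne']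
      · have hi' := hi
        simp only [S, Finset.mem_insert, Finset.mem_singleton, not_or] at hi'
        fin_cases k <;> simp [hi, hi'.1, hi'.2.1, hi'.2.2.1, hi'.2.2.2]
    · intro e he k
      have h1 := he b
      have h2 := he c
      have h3 := he d
      simp [Fin.sum_univ_three, hab.ne', hac.ne', had.ne', hbc.ne', hbd.ne', hcd.ne', hbc.ne,
        hbd.ne, hcd.ne] at h1 h2 h3
      fin_cases k <;> simp [h1, h2, h3]
  · ext i j
    simp only [A, Matrix.transpose_apply, Matrix.of_apply, and_comm, eq_comm]
  · intro i j hij h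
    by_cases h' : i ∈ S ∧ j ∈ S
    · exact hS i h'.1 j h'.2 hij
    · exact absurd (by simp only [A, Matrix.of_apply, h', hij, or_self, if_false]) h
  · intro X hX hAX _ hXA
    ext i j
    by_cases hi : i ∈ S
    · by_cases hj : j ∈ S
      · exact hXA i j (by simp [A, hi, hj])
      · rw [← hX.apply]
        have : A.mulVec (fun k => X k i) j = 0 := congrFun (congrFun hAX j) i
        rwa [hmul, if_neg hj] at this
    · have : A.mulVec (fun k => X k j) i = 0 := congrFun (congrFun hAX i) j
      rwa [hmul, if_neg hi] at this

/-- If three disjoint connected vertex sets are each joined to both of two further vertices, as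
in a subdivision of `K₂,₃`, then `M(G) ≥ 3`.

The matrix is put together from the Laplacians of the three sets `D i` and one edge from each of
`u`, `v` to each set. Its kernel consists of the vectors which take opposite values `y`, `-y` at
`u`, `v`, and equal `c i - y g` on `D i` with `∑ c i = 0`. -/
theorem three_le_maxMult_of_theta {V : Type*} [Fintype V] {G : SimpleGraph V} {u v : V}
    (huv : u ≠ v) (D : Fin 3 → Set V) (hdisj : ∀ i j, i ≠ j → Disjoint (D i) (D j))
    (hconn : ∀ i, (G.induce (D i)).Preconnected) (hu : ∀ i, u ∉ D i) (hv : ∀ i, v ∉ D i)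
    (hua : ∀ i, ∃ a ∈ D i, G.Adj u a) (hvb : ∀ i, ∃ b ∈ D i, G.Adj v b) : 3 ≤ maxMult G := by
  classical
  choose a haD hua using hua
  choose b hbD hvb using hvb
  have hD : ∀ {i j x}, x ∈ D i → x ∈ D j → i = j := fun {i j x} hi hj => by
    by_contra hij
    exact Set.disjoint_left.1 (hdisj i j hij) hi hj
  let K : SimpleGraph V :=
    { Adj := fun x y => G.Adj x y ∧ ∃ i, x ∈ D i ∧ y ∈ D i
      symm := ⟨fun x y h => ⟨h.1.symm, h.2.imp fun i hi => hi.symm⟩⟩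
      loopless := ⟨fun x h => G.irrefl h.1⟩ }
  have hKreach : ∀ i, ∀ x ∈ D i, ∀ y ∈ D i, K.Reachable x y := fun i x hx y hy =>
    (hconn i ⟨x, hx⟩ ⟨y, hy⟩).map
      (⟨Subtype.val, fun {p q} h => ⟨h, i, p.2, q.2⟩⟩ : G.induce (D i) →g K)
  let L := K.lapMatrix ℝ
  let M : Matrix V V ℝ := L + Matrix.diagonal fun x => if ∃ i, x ∈ D i then 0 else 1
  have hMs : M.IsSymm := (K.isSymm_lapMatrix (R := ℝ)).add (Matrix.isSymm_diagonal _)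
  have hMout : ∀ (x : V → ℝ) p, (¬ ∃ i, p ∈ D i) → M.mulVec x p = x p := fun x p hp => by
    have h1 : ∀ q, ¬ K.Adj p q := fun q h => hp (h.2.imp fun i hi => hi.1)
    have h2 : K.neighborFinset p = ∅ := by
      ext q; simp [h1]
    rw [Matrix.add_mulVec, Pi.add_apply, Matrix.mulVec_diagonal, if_neg hp,
      SimpleGraph.lapMatrix_mulVec_apply, h2, ← SimpleGraph.card_neighborFinset_eq_degree, h2]
    simp
  have hMin : ∀ (x : V → ℝ) p, (∃ i, p ∈ D i) → M.mulVec x p = L.mulVec x p := fun x p hp => by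
    rw [Matrix.add_mulVec, Pi.add_apply, Matrix.mulVec_diagonal, if_pos hp]
    simp
  have hMker : ∀ x, M.mulVec x = 0 →
      (∀ p, (¬ ∃ i, p ∈ D i) → x p = 0) ∧ ∀ i, ∀ p ∈ D i, x p = x (a i) := fun x hx => by
    have h0 : ∀ p, (¬ ∃ i, p ∈ D i) → x p = 0 := fun p hp => by
      rw [← hMout x p hp, hx]; rfl
    refine ⟨h0, fun i p hp => ?_⟩
    have hL : L.mulVec x = 0 := by
      ext p
      by_cases hp : ∃ i, p ∈ D i
      · rw [← hMin x p hp, hx]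
      · have h2 : K.neighborFinset p = ∅ := by
          ext q
          simp only [SimpleGraph.mem_neighborFinset, Finset.notMem_empty, iff_false]
          exact fun h => hp (h.2.imp fun i hi => hi.1)
        rw [SimpleGraph.lapMatrix_mulVec_apply, h0 p hp, h2]
        simp
    exact K.lapMatrix_mulVec_eq_zero_iff_forall_reachable.1 hL p (a i)
      (hKreach i p hp (a i) (haD i))
  let s : V → ℝ := ∑ i, Pi.single (a i) 1
  let t : V → ℝ := ∑ i, Pi.single (b i) 1
  have hsdot : ∀ x : V → ℝ, s ⬝ᵥ x = ∑ i, x (a i) := fun x => by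
    simp [s, sum_dotProduct]
  have htdot : ∀ x : V → ℝ, t ⬝ᵥ x = ∑ i, x (b i) := fun x => by
    simp [t, sum_dotProduct]
  have hs0 : ∀ p, s p ≠ 0 → ∃ i, p = a i := fun p hp => by
    by_contra! h
    exact hp (by simp [s, Finset.sum_apply, h])
  have ht0 : ∀ p, t p ≠ 0 → ∃ i, p = b i := fun p hp => by
    by_contra! h
    exact hp (by simp [t, Finset.sum_apply, h])
  have hsu : ∀ p, (¬ ∃ i, p ∈ D i) → s p = 0 := fun p hp => by
    by_contra h
    obtain ⟨i, rfl⟩ := hs0 p h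
    exact hp ⟨i, haD i⟩
  have htu : ∀ p, (¬ ∃ i, p ∈ D i) → t p = 0 := fun p hp => by
    by_contra h
    obtain ⟨i, rfl⟩ := ht0 p h
    exact hp ⟨i, hbD i⟩
  have hu' : ¬ ∃ i, u ∈ D i := fun ⟨i, hi⟩ => hu i hi
  have hv' : ¬ ∃ i, v ∈ D i := fun ⟨i, hi⟩ => hv i hi
  obtain ⟨g, hg⟩ := hMs.exists_mulVec_eq (s - t) fun y hy => by
    rw [dotProduct_comm, sub_dotProduct, hsdot, htdot, ← Finset.sum_sub_distrib]
    exact Finset.sum_eq_zero fun i _ => by rw [(hMker y hy).2 i (b i) (hbD i), sub_self]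
  have hg0 : ∀ p, (¬ ∃ i, p ∈ D i) → g p = 0 := fun p hp => by
    rw [← hMout g p hp, hg, Pi.sub_apply, hsu p hp, htu p hp, sub_zero]
  let eu : V → ℝ := Pi.single u 1
  let ev : V → ℝ := Pi.single v 1
  have heu : eu u = 1 := by simp [eu]
  have hev : ev v = 1 := by simp [ev]
  have heuv : eu v = 0 := by simp [eu, huv.symm]
  have hevu : ev u = 0 := by simp [ev, huv]
  let A : Matrix V V ℝ := Matrix.of fun i j => M i j + (eu i * s j + s i * eu j) +
    (ev i * t j + t i * ev j) + (s ⬝ᵥ g - 1) * (eu i * eu j) + (-(t ⬝ᵥ g) - 1) * (ev i * ev j)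
  have hAs : A.IsSymm := by
    ext i j
    simp only [A, Matrix.transpose_apply, Matrix.of_apply, hMs.apply i j]
    ring
  have hmul : ∀ (x : V → ℝ) p, A.mulVec x p = M.mulVec x p + (eu p * (s ⬝ᵥ x) + s p * x u) +
      (ev p * (t ⬝ᵥ x) + t p * x v) + (s ⬝ᵥ g - 1) * (eu p * x u) +
      (-(t ⬝ᵥ g) - 1) * (ev p * x v) := fun x p => by
    have h1 : eu ⬝ᵥ x = x u := by simp [eu]
    have h2 : ev ⬝ᵥ x = x v := by simp [ev]
    rw [← h1, ← h2]
    simp only [Matrix.mulVec, dotProduct, A, Matrix.of_apply, add_mul, Finset.sum_add_distrib,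
      Finset.mul_sum, mul_assoc]
  have hAu : ∀ x : V → ℝ, A.mulVec x u = s ⬝ᵥ x + (s ⬝ᵥ g) * x u := fun x => by
    rw [hmul, hMout x u hu', heu, hevu, hsu u hu', htu u hu']
    ring
  have hAv : ∀ x : V → ℝ, A.mulVec x v = t ⬝ᵥ x - (t ⬝ᵥ g) * x v := fun x => by
    rw [hmul, hMout x v hv', hev, heuv, hsu v hv', htu v hv']
    ring
  have hAw : ∀ (x : V → ℝ) p, p ≠ u → p ≠ v →
      A.mulVec x p = M.mulVec x p + s p * x u + t p * x v := fun x p hpu hpv => by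
    rw [hmul, show eu p = 0 by simp [eu, hpu], show ev p = 0 by simp [ev, hpv]]
    ring
  let χ : Fin 3 → V → ℝ := fun i p => if p ∈ D i then 1 else 0
  have hχM : ∀ i, M.mulVec (χ i) = 0 := fun i => by
    have hL : L.mulVec (χ i) = 0 := by
      rw [SimpleGraph.lapMatrix_mulVec_eq_zero_iff_forall_adj]
      rintro p q ⟨-, j, hp, hq⟩
      by_cases h : i = j
      · subst h; simp [χ, hp, hq]
      · have h1 : p ∉ D i := fun h' => h (hD h' hp)
        have h2 : q ∉ D i := fun h' => h (hD h' hq)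
        simp [χ, h1, h2]
    ext p
    by_cases hp : ∃ i, p ∈ D i
    · rw [hMin _ _ hp, hL]
    · rw [hMout _ _ hp]
      have : p ∉ D i := fun h => hp ⟨i, h⟩
      simp [χ, this]
  have hχs : ∀ i, s ⬝ᵥ χ i = 1 := fun i => by
    rw [hsdot, Finset.sum_eq_single i]
    · simp [χ, haD]
    · intro j _ hj
      have : a j ∉ D i := fun h => hj (hD (haD j) h)
      simp [χ, this]
    · simp
  have hχt : ∀ i, t ⬝ᵥ χ i = 1 := fun i => by
    rw [htdot, Finset.sum_eq_single i]
    · simp [χ, hbD]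
    · intro j _ hj
      have : b j ∉ D i := fun h => hj (hD (hbD j) h)
      simp [χ, this]
    · simp
  have hχA : ∀ i, A.mulVec (χ i) = eu + ev := fun i => by
    ext p
    have h1 : χ i u = 0 := by simp [χ, hu]
    have h2 : χ i v = 0 := by simp [χ, hv]
    rw [hmul, hχM, hχs, hχt, h1, h2]
    simp
  have hAker : ∀ x, A.mulVec x = 0 → x u = 0 → x v = 0 →
      M.mulVec x = 0 ∧ ∑ i, x (a i) = 0 := fun x hx hxu hxv => by
    have h1 := hAu x
    have h2 := hAv x
    rw [hx, hxu, mul_zero, add_zero, Pi.zero_apply] at h1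
    rw [hx, hxv, mul_zero, sub_zero, Pi.zero_apply] at h2
    refine ⟨?_, by rw [← hsdot, ← h1]⟩
    ext p
    have h3 := hmul x p
    rw [hx, hxu, hxv, ← h1, ← h2] at h3
    simpa using h3.symm
  refine le_trans ?_ (finrank_ker_le_maxMult_of_strongArnold (A := A) hAs ?_ ?_)
  · refine Matrix.three_le_finrank_ker ![χ 0 - χ 1, χ 1 - χ 2, eu - ev - g] ?_ ?_
    · have h3 : A.mulVec (eu - ev - g) = 0 := by
        have h4 : (eu - ev - g) u = 1 := by simp [heu, hevu, hg0 u hu']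
        have h5 : (eu - ev - g) v = -1 := by simp [heuv, hev, hg0 v hv']
        have h6 : ∀ i, (eu - ev - g) (a i) = - g (a i) := fun i => by
          have h7 : a i ≠ u := fun h => hu i (h ▸ haD i)
          have h8 : a i ≠ v := fun h => hv i (h ▸ haD i)
          simp [eu, ev, h7, h8]
        have h6' : ∀ i, (eu - ev - g) (b i) = - g (b i) := fun i => by
          have h7 : b i ≠ u := fun h => hu i (h ▸ hbD i)
          have h8 : b i ≠ v := fun h => hv i (h ▸ hbD i)
          simp [eu, ev, h7, h8]
        ext p
        by_cases hpu : p = u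
        · subst hpu
          rw [hAu, hsdot, h4, hsdot]
          simp [h6]
        · by_cases hpv : p = v
          · subst hpv
            rw [hAv, htdot, h5, htdot]
            simp [h6']
          · rw [hAw _ _ hpu hpv, h4, h5, Matrix.mulVec_sub, hg]
            have h9 : M.mulVec (eu - ev) p = 0 := by
              by_cases hp : ∃ i, p ∈ D i
              · have hK : ∀ q, (¬ ∃ i, q ∈ D i) → M p q = 0 := fun q hq => by
                  have h10 : M q p = 0 := by
                    have h11 := hMout (Pi.single p 1) q hq
                    have h12 : q ≠ p := fun h => hq (h ▸ hp)
                    simpa [h12] using h11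
                  rw [← hMs.apply, h10]
                rw [Matrix.mulVec_sub, Pi.sub_apply]
                simp [eu, ev, hK u hu', hK v hv']
              · rw [hMout _ _ hp]
                simp [eu, ev, hpu, hpv]
            rw [Pi.sub_apply, h9]
            simp
      intro i
      fin_cases i
      · change A.mulVec (χ 0 - χ 1) = 0
        rw [Matrix.mulVec_sub, hχA, hχA, sub_self]
      · change A.mulVec (χ 1 - χ 2) = 0
        rw [Matrix.mulVec_sub, hχA, hχA, sub_self]
      · exact h3
    · intro c hc
      have hχa : ∀ i j, χ i (a j) = if i = j then 1 else 0 := fun i j => by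
        by_cases h : i = j
        · subst h; simp [χ, haD]
        · have : a j ∉ D i := fun h' => h (hD h' (haD j))
          simp [χ, this, h]
      have h2 : c 2 = 0 := by
        have := hc u
        simpa [Fin.sum_univ_three, χ, hu, heu, hevu, hg0 u hu'] using this
      have h0 : c 0 = 0 := by
        have := hc (a 0)
        simpa [Fin.sum_univ_three, hχa, h2] using this
      have h1 : c 1 = 0 := by
        have := hc (a 2)
        simpa [Fin.sum_univ_three, hχa, h2] using this
      intro i
      fin_cases i <;> assumption
  · intro i j hij hAij
    by_contra hG
    refine hAij ?_
    have h1 : M i j = 0 := by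
      have h2 : ¬ K.Adj i j := fun h => hG h.1
      simp [M, L, SimpleGraph.lapMatrix, SimpleGraph.degMatrix, hij, h2]
    have h2 : ∀ p q, ¬ G.Adj p q → eu p * s q = 0 := fun p q hpq => by
      by_contra h
      obtain ⟨k, rfl⟩ := hs0 q (right_ne_zero_of_mul h)
      have hp : p = u := by
        by_contra hp
        exact h (by simp [eu, hp])
      exact hpq (hp ▸ hua k)
    have h3 : ∀ p q, ¬ G.Adj p q → ev p * t q = 0 := fun p q hpq => by
      by_contra h
      obtain ⟨k, rfl⟩ := ht0 q (right_ne_zero_of_mul h)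
      have hp : p = v := by
        by_contra hp
        exact h (by simp [ev, hp])
      exact hpq (hp ▸ hvb k)
    have h4 : eu i * eu j = 0 := by
      by_cases h : i = u
      · simp [eu, show j ≠ u from fun h' => hij (h.trans h'.symm)]
      · simp [eu, h]
    have h5 : ev i * ev j = 0 := by
      by_cases h : i = v
      · simp [ev, show j ≠ v from fun h' => hij (h.trans h'.symm)]
      · simp [ev, h]
    have hG' : ¬ G.Adj j i := fun h => hG h.symm
    simp only [A, Matrix.of_apply]
    rw [h1, h2 i j hG, h3 i j hG, h4, h5, mul_comm (s i), mul_comm (t i), h2 j i hG', h3 j i hG']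
    simp
  · intro X hX hAX hXd hXA
    have hcol : ∀ q, A.mulVec (fun p => X p q) = 0 := fun q => funext fun p =>
      congrFun (congrFun hAX p) q
    -- Pairing a column with an indicator `χ i` shows that its entries at `u`, `v` are opposite.
    have hrow : ∀ q, X u q + X v q = 0 := fun q => by
      have h1 : χ 0 ⬝ᵥ A.mulVec (fun p => X p q) = 0 := by rw [hcol, dotProduct_zero]
      rw [Matrix.dotProduct_mulVec, ← Matrix.mulVec_transpose, hAs.eq, hχA, add_dotProduct] at h1
      simpa [eu, ev] using h1
    have hXvu : X v u = 0 := by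
      have := hrow u
      rwa [hXd, zero_add] at this
    have hXu : ∀ p, X p u = 0 := fun p => by
      obtain ⟨h1, -⟩ := hAker _ (hcol u) (hXd u) hXvu
      by_cases hp : ∃ i, p ∈ D i
      · obtain ⟨i, hi⟩ := hp
        refine ((hMker _ h1).2 i p hi).trans ?_
        rw [← hX.apply]
        refine hXA u (a i) ?_
        have h7 : a i ≠ u := fun h => hu i (h ▸ haD i)
        have h8 : a i ≠ v := fun h => hv i (h ▸ haD i)
        have h9 : M u (a i) = 0 := by
          have h11 := hMout (Pi.single (a i) 1) u hu'
          simpa [h7.symm] using h11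
        have h10 : s (a i) = 1 := by
          have h12 : ∀ j, a i = a j ↔ j = i := fun j =>
            ⟨fun h => hD (haD j) (h ▸ haD i), fun h => by rw [h]⟩
          simp [s, Finset.sum_apply, Pi.single_apply, h12]
        simp only [A, Matrix.of_apply, h9, h10, heu, hevu, hsu u hu', htu u hu']
        simp [eu, ev, h7, h8]
      · exact (hMker _ h1).1 p hp
    have hXu' : ∀ q, X u q = 0 := fun q => by rw [← hX.apply]; exact hXu q
    have hXv' : ∀ q, X v q = 0 := fun q => by
      have := hrow q
      rwa [hXu', zero_add] at this
    have hcol' := fun q => hAker _ (hcol q) (hXu' q) (hXv' q)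
    have haa : ∀ i j, X (a i) (a j) = 0 := by
      have h1 : ∀ i, X (a i) (a i) = 0 := fun i => hXd _
      have h2 : ∀ i j, X (a i) (a j) = X (a j) (a i) := fun i j => hX.apply _ _
      have h3 : ∀ j, X (a 0) (a j) + X (a 1) (a j) + X (a 2) (a j) = 0 := fun j => by
        rw [← Fin.sum_univ_three (fun i => X (a i) (a j))]
        exact (hcol' (a j)).2
      have h4 := h3 0
      have h5 := h3 1
      have h6 := h3 2
      have h7 := h1 0
      have h8 := h1 1
      have h9 := h1 2
      have h10 := h2 0 1
      have h11 := h2 0 2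
      have h12 := h2 1 2
      intro i j
      fin_cases i <;> fin_cases j <;>
        simp only [Fin.zero_eta, Fin.mk_one, Fin.reduceFinMk] <;> linarith
    ext p q
    rw [Matrix.zero_apply]
    by_cases hp : ∃ i, p ∈ D i
    · obtain ⟨i, hi⟩ := hp
      refine ((hMker _ (hcol' q).1).2 i p hi).trans ?_
      rw [← hX.apply]
      by_cases hq : ∃ j, q ∈ D j
      · obtain ⟨j, hj⟩ := hq
        exact ((hMker _ (hcol' (a i)).1).2 j q hj).trans (haa j i)
      · exact (hMker _ (hcol' (a i)).1).1 q hq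
    · exact (hMker _ (hcol' q).1).1 p hp

/-! ### Cut vertices -/

/-- A vertex of `U` farthest from `v` is not a cut vertex, so there is a matrix of nullity two as
soon as all vertices other than `v` have two neighbours. -/
theorem hasNullity_two_of_two_neighbors {V : Type*} [Fintype V] (K : SimpleGraph V) {U : Set V}
    {v : V} (hU : ∀ i j, K.Adj i j → i ∈ U) (hreach : ∀ x ∈ U, K.Reachable x v)
    (hdeg : ∀ x ∈ U, x ≠ v → ∃ a b, a ≠ b ∧ K.Adj x a ∧ K.Adj x b) (hne : ∃ x ∈ U, x ≠ v) :
    HasNullity K U 2 := by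
  classical
  obtain ⟨u, ⟨huU, huv⟩, hmax⟩ := Set.exists_max_image {x | x ∈ U ∧ x ≠ v} (fun x => K.dist x v)
    (Set.toFinite _) hne
  obtain ⟨a, b, hab, ha, hb⟩ := hdeg u huU huv
  have key : ∀ n, ∀ x ∈ U, x ≠ u → K.dist x v = n → (K.deleteIncidenceSet u).Reachable x v := by
    intro n
    induction n using Nat.strong_induction_on with
    | _ n ih =>
      intro x hx hxu hn
      by_cases hxv : x = v
      · rw [hxv]
      · obtain ⟨p, hp⟩ := (hreach x hx).exists_walk_length_eq_dist
        cases p with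
        | nil => exact absurd rfl hxv
        | @cons _ y _ h p =>
          rw [SimpleGraph.Walk.length_cons] at hp
          have h1 := SimpleGraph.dist_le p
          have h2 := hmax x ⟨hx, hxv⟩
          have hyu : y ≠ u := by
            rintro rfl
            omega
          exact (SimpleGraph.Adj.reachable
            (SimpleGraph.deleteIncidenceSet_adj.2 ⟨h, hxu, hyu⟩)).trans
            (ih _ (by omega) y (hU _ _ h.symm) hyu rfl)
  exact hasNullity_two_of_connected_delete K U huU hU
    (fun x hx y hy hxu hyu => (key _ x hx hxu rfl).trans (key _ y hy hyu rfl).symm) hab ha hb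

theorem hasNullity_two_of_closed {V : Type*} [Fintype V] {G : SimpleGraph V}
    (hG : G.Connected) (hdeg : ∀ x, ∃ a b, a ≠ b ∧ G.Adj x a ∧ G.Adj x b) {U : Set V} {v : V}
    (hv : v ∈ U) (hclosed : ∀ x ∈ U, x ≠ v → ∀ y, G.Adj x y → y ∈ U) (hne : ∃ x ∈ U, x ≠ v) :
    HasNullity ((⊤ : G.Subgraph).induce U).spanningCoe U 2 := by
  refine hasNullity_two_of_two_neighbors _ (fun i j h => h.1) ?_ ?_ hne
  · have key : ∀ {x} (p : G.Walk x v), x ∈ U →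
        ((⊤ : G.Subgraph).induce U).spanningCoe.Reachable x v := by
      intro x p
      induction p with
      | nil => exact fun _ => SimpleGraph.Reachable.refl _
      | @cons x y v h p ih =>
        intro hx
        by_cases hxv : x = v
        · rw [hxv]
        · have hy := hclosed x hx hxv y h
          have hadj : ((⊤ : G.Subgraph).induce U).spanningCoe.Adj x y := ⟨hx, hy, h⟩
          exact hadj.reachable.trans (ih hv hclosed hne hy)
    intro x hx
    obtain ⟨p⟩ := hG.preconnected x v
    exact key p hx
  · intro x hx hxv
    obtain ⟨a, b, hab, ha, hb⟩ := hdeg x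
    exact ⟨a, b, hab, ⟨hx, hclosed x hx hxv a ha, ha⟩, ⟨hx, hclosed x hx hxv b hb, hb⟩⟩

/-- A cut vertex `v` forces `M(G) ≥ 3`: matrices of nullity two on either side of `v` are added,
and only one is lost for the common vertex. -/
theorem three_le_maxMult_of_cut_vertex {V : Type*} [Fintype V] {G : SimpleGraph V}
    (hG : G.Connected) (hdeg : ∀ x, ∃ a b, a ≠ b ∧ G.Adj x a ∧ G.Adj x b) {v x y : V}
    (hx : x ≠ v) (hy : y ≠ v) (hxy : ¬ (G.deleteIncidenceSet v).Reachable x y) :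
    3 ≤ maxMult G := by
  let D : Set V := {w | w ≠ v ∧ (G.deleteIncidenceSet v).Reachable x w}
  have hD : ∀ w ∈ D, ∀ z, z ≠ v → G.Adj w z → z ∈ D := fun w hw z hz h =>
    ⟨hz, hw.2.trans (SimpleGraph.Adj.reachable
      (SimpleGraph.deleteIncidenceSet_adj.2 ⟨h, hw.1, hz⟩))⟩
  have hvD : v ∉ D := fun h => h.1 rfl
  have h1 := hasNullity_two_of_closed hG hdeg (U := insert v D) (v := v) (Set.mem_insert _ _)
    (fun w hw hwv z hz => by
      by_cases h : z = v
      · exact Or.inl h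
      · exact Or.inr (hD w (hw.resolve_left hwv) z h hz))
    ⟨x, Or.inr ⟨hx, SimpleGraph.Reachable.refl _⟩, hx⟩
  have h2 := hasNullity_two_of_closed hG hdeg (U := Dᶜ) (v := v) hvD
    (fun w hw hwv z hz hzD => hw (hD z hzD w hwv hz.symm)) ⟨y, fun h => hxy h.2, hy⟩
  have hint : insert v D ∩ Dᶜ = {v} := by
    ext w
    simp only [Set.mem_inter_iff, Set.mem_insert_iff, Set.mem_compl_iff, Set.mem_singleton_iff]
    constructor
    · rintro ⟨h | h, h'⟩
      · exact h
      · exact absurd h h'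
    · rintro rfl
      exact ⟨Or.inl rfl, hvD⟩
  refine HasNullity.le_maxMult ((h1.glue h2 (k := 3) (by rw [hint, Set.ncard_singleton])).congr
    ?_ ?_ rfl)
  · ext p q
    simp only [SimpleGraph.sup_adj, SimpleGraph.Subgraph.spanningCoe_adj,
      SimpleGraph.Subgraph.induce_adj, SimpleGraph.Subgraph.top_adj, Set.mem_insert_iff,
      Set.mem_compl_iff]
    constructor
    · rintro (h | h) <;> exact h.2.2
    · intro h
      have h3 := hD p
      have h4 := hD q
      by_cases hp : p ∈ D
      · by_cases hqv : q = v
        · exact Or.inl ⟨Or.inr hp, Or.inl hqv, h⟩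
        · exact Or.inl ⟨Or.inr hp, Or.inr (h3 hp q hqv h), h⟩
      · by_cases hq : q ∈ D
        · by_cases hpv : p = v
          · exact Or.inl ⟨Or.inl hpv, Or.inr hq, h⟩
          · exact absurd (h4 hq p hpv h.symm) hp
        · exact Or.inr ⟨hp, hq, h⟩
  · ext w
    by_cases h : w ∈ D <;> simp [h]

/-! ### Arcs of cycles and Hamiltonian cycles -/

/-- The interior of a path which is not a single edge is connected and joined to both ends. -/
theorem SimpleGraph.Walk.IsPath.interior {V : Type*} {G : SimpleGraph V} {x y : V}
    {p : G.Walk x y} (hp : p.IsPath) (hxy : x ≠ y) (he : s(x, y) ∉ p.edges) :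
    (G.induce {w | w ∈ p.support ∧ w ≠ x ∧ w ≠ y}).Preconnected ∧
      (∃ a, (a ∈ p.support ∧ a ≠ x ∧ a ≠ y) ∧ G.Adj x a) ∧
      ∃ b, (b ∈ p.support ∧ b ≠ x ∧ b ≠ y) ∧ G.Adj y b := by
  cases p with
  | nil => exact absurd rfl hxy
  | @cons _ a _ h q =>
    rw [SimpleGraph.Walk.cons_isPath_iff] at hp
    have hay : a ≠ y := by
      rintro rfl
      exact he (by simp)
    have hq' := hp.1.reverse
    have hsupp : ∀ w, w ∈ q.support ↔ w ∈ q.reverse.support := fun w => by simp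
    generalize q.reverse = r at hq' hsupp
    cases r with
    | nil => exact absurd rfl hay
    | @cons _ b _ h' r =>
      rw [SimpleGraph.Walk.cons_isPath_iff] at hq'
      have hset : {w | w ∈ (SimpleGraph.Walk.cons h q).support ∧ w ≠ x ∧ w ≠ y} =
          {w | w ∈ r.support} := by
        ext w
        change w ∈ (SimpleGraph.Walk.cons h q).support ∧ w ≠ x ∧ w ≠ y ↔ w ∈ r.support
        have h1 := hsupp w
        rw [SimpleGraph.Walk.support_cons, List.mem_cons] at h1 ⊢
        constructor
        · rintro ⟨h2, h3, h4⟩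
          exact (h1.1 (h2.resolve_left h3)).resolve_left h4
        · intro h2
          have h3 := h1.2 (Or.inr h2)
          exact ⟨Or.inr h3, fun h4 => hp.2 (h4 ▸ h3), fun h4 => hq'.2 (h4 ▸ h2)⟩
      have hmem : ∀ w, (w ∈ (SimpleGraph.Walk.cons h q).support ∧ w ≠ x ∧ w ≠ y) ↔
          w ∈ r.support := fun w => Set.ext_iff.1 hset w
      refine ⟨?_, ⟨a, (hmem a).2 (by simp), h⟩, ⟨b, (hmem b).2 (by simp), h'⟩⟩
      rw [hset]
      exact r.connected_induce_support.preconnected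

/-- Two vertices of a cycle which are not consecutive separate it into two arcs. -/
theorem IsCycleSubgraph.exists_arcs {V : Type*} {G : SimpleGraph V} {Z : G.Subgraph}
    (hZ : IsCycleSubgraph Z) {x y : V} (hx : x ∈ Z.verts) (hy : y ∈ Z.verts) (hxy : x ≠ y)
    (hadj : ¬ Z.Adj x y) :
    ∃ D₁ D₂ : Set V, Disjoint D₁ D₂ ∧ ∀ D, (D = D₁ ∨ D = D₂) →
      D ⊆ Z.verts \ {x, y} ∧ (G.induce D).Preconnected ∧ (∃ a ∈ D, G.Adj x a) ∧
        ∃ b ∈ D, G.Adj y b := by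
  classical
  obtain ⟨r, c, hc, rfl⟩ := hZ
  rw [SimpleGraph.Walk.mem_verts_toSubgraph] at hx
  rw [← SimpleGraph.Walk.toSubgraph_rotate c hx] at hy hadj ⊢
  replace hc := hc.rotate hx
  generalize c.rotate x hx = c at hc hy hadj ⊢
  rw [SimpleGraph.Walk.mem_verts_toSubgraph] at hy
  rw [← SimpleGraph.Subgraph.mem_edgeSet, SimpleGraph.Walk.mem_edges_toSubgraph] at hadj
  have hspec := c.take_spec hy
  generalize c.takeUntil y hy = p at hspec
  generalize c.dropUntil y hy = q at hspec
  subst hspec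
  have hp : p.IsPath := hc.isPath_of_append_left fun h => hxy h.eq.symm
  have hq : q.IsPath := hc.isPath_of_append_right fun h => hxy h.eq
  rw [SimpleGraph.Walk.edges_append, List.mem_append, not_or] at hadj
  obtain ⟨hp1, hp2, hp3⟩ := hp.interior hxy hadj.1
  obtain ⟨hq1, hq2, hq3⟩ := hq.interior hxy.symm (by rw [Sym2.eq_swap]; exact hadj.2)
  have hnd := hc.support_nodup
  rw [SimpleGraph.Walk.tail_support_append, List.nodup_append'] at hnd
  refine ⟨{w | w ∈ p.support ∧ w ≠ x ∧ w ≠ y}, {w | w ∈ q.support ∧ w ≠ y ∧ w ≠ x}, ?_, ?_⟩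
  · rw [Set.disjoint_left]
    rintro w ⟨h1, h2, h3⟩ ⟨h4, -, -⟩
    exact hnd.2.2 (((SimpleGraph.Walk.mem_support_iff p).1 h1).resolve_left h2)
      (((SimpleGraph.Walk.mem_support_iff q).1 h4).resolve_left h3)
  · rintro D (rfl | rfl)
    · refine ⟨?_, hp1, hp2, hp3⟩
      rintro w ⟨h1, h2, h3⟩
      refine ⟨?_, by simp [h2, h3]⟩
      rw [SimpleGraph.Walk.mem_verts_toSubgraph, SimpleGraph.Walk.mem_support_append_iff]
      exact Or.inl h1
    · refine ⟨?_, hq1, hq3, hq2⟩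
      rintro w ⟨h1, h2, h3⟩
      refine ⟨?_, by simp [h2, h3]⟩
      rw [SimpleGraph.Walk.mem_verts_toSubgraph, SimpleGraph.Walk.mem_support_append_iff]
      exact Or.inr h1

/-- Removing the edge `ab` from a cycle leaves a path from `b` to `a`. -/
theorem IsCycleSubgraph.exists_path {V : Type*} {G : SimpleGraph V} {Z : G.Subgraph}
    (hZ : IsCycleSubgraph Z) {a b : V} (hab : Z.Adj a b) :
    ∃ p : G.Walk b a, p.IsPath ∧ (∀ w, w ∈ p.support ↔ w ∈ Z.verts) ∧
      ∀ e, e ∈ p.edges ↔ e ∈ Z.edgeSet ∧ e ≠ s(a, b) := by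
  classical
  obtain ⟨c, hc, hcZ, hcb⟩ : ∃ c : G.Walk a a, c.IsCycle ∧ c.toSubgraph = Z ∧ c.snd = b := by
    obtain ⟨r, c, hc, rfl⟩ := hZ
    have ha : a ∈ c.support := c.mem_verts_toSubgraph.1 (SimpleGraph.Subgraph.edge_vert _ hab)
    rw [← SimpleGraph.Walk.toSubgraph_rotate c ha] at hab ⊢
    replace hc := hc.rotate ha
    generalize c.rotate a ha = c at hc hab ⊢
    have hb : b ∈ c.toSubgraph.neighborSet a := hab
    rw [hc.neighborSet_toSubgraph_endpoint] at hb
    rcases hb with hb | hb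
    · exact ⟨c, hc, rfl, hb.symm⟩
    · exact ⟨c.reverse, hc.reverse, c.toSubgraph_reverse, by simpa using hb.symm⟩
  subst hcZ
  cases c with
  | nil => exact absurd hc SimpleGraph.Walk.not_isCycle_nil
  | @cons _ b' _ h q =>
    rw [SimpleGraph.Walk.snd_cons] at hcb
    subst hcb
    obtain ⟨hq, hqe⟩ := (SimpleGraph.Walk.cons_isCycle_iff q h).1 hc
    refine ⟨q, hq, fun w => ?_, fun e => ?_⟩
    · rw [SimpleGraph.Walk.mem_verts_toSubgraph, SimpleGraph.Walk.support_cons, List.mem_cons]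
      refine ⟨Or.inr, ?_⟩
      rintro (rfl | h')
      · exact q.end_mem_support
      · exact h'
    · rw [SimpleGraph.Walk.mem_edges_toSubgraph, SimpleGraph.Walk.edges_cons, List.mem_cons]
      constructor
      · intro he
        exact ⟨Or.inr he, fun h' => hqe (h' ▸ he)⟩
      · rintro ⟨h1 | h1, h2⟩
        · exact absurd h1 h2
        · exact h1

/-- Two cycles sharing exactly an edge and its ends merge into one cycle after removal of the
edge. -/
theorem IsCycleSubgraph.exists_merge {V : Type*} {G : SimpleGraph V} {Z₁ Z₂ : G.Subgraph}
    (h₁ : IsCycleSubgraph Z₁) (h₂ : IsCycleSubgraph Z₂) {a b : V} (hab₁ : Z₁.Adj a b)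
    (hab₂ : Z₂.Adj a b) (hverts : Z₁.verts ∩ Z₂.verts = {a, b}) :
    ∃ Z : G.Subgraph, IsCycleSubgraph Z ∧ Z.verts = Z₁.verts ∪ Z₂.verts ∧
      ∀ e, e ∈ Z.edgeSet ↔ (e ∈ Z₁.edgeSet ∨ e ∈ Z₂.edgeSet) ∧ e ≠ s(a, b) := by
  classical
  obtain ⟨p, hp, hps, hpe⟩ := h₁.exists_path hab₁
  obtain ⟨q, hq, hqs, hqe⟩ := h₂.exists_path hab₂.symm
  rw [Sym2.eq_swap] at hqe
  have hne := hab₁.ne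
  refine ⟨(p.append q).toSubgraph, ⟨b, _, ?_, rfl⟩, ?_, fun e => ?_⟩
  · rw [SimpleGraph.Walk.isCycle_def]
    refine ⟨⟨?_⟩, ?_, ?_⟩
    · rw [SimpleGraph.Walk.edges_append, List.nodup_append']
      refine ⟨hp.isTrail.edges_nodup, hq.isTrail.edges_nodup, fun e he he' => ?_⟩
      exact ((hpe e).1 he).2 (SimpleGraph.Subgraph.eq_of_mem_edgeSet_of_inter_eq_pair hverts
        ((hpe e).1 he).1 ((hqe e).1 he').1)
    · intro h
      have h1 := congrArg SimpleGraph.Walk.length h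
      rw [SimpleGraph.Walk.length_append, SimpleGraph.Walk.length_nil] at h1
      exact hne (SimpleGraph.Walk.eq_of_length_eq_zero (p := p) (by omega)).symm
    · have hpn := hp.support_nodup
      have hqn := hq.support_nodup
      rw [← SimpleGraph.Walk.cons_tail_support, List.nodup_cons] at hpn hqn
      rw [SimpleGraph.Walk.tail_support_append, List.nodup_append']
      refine ⟨hpn.2, hqn.2, fun w hw hw' => ?_⟩
      have h3 : w ∈ Z₁.verts ∩ Z₂.verts :=
        ⟨(hps w).1 (List.mem_of_mem_tail hw), (hqs w).1 (List.mem_of_mem_tail hw')⟩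
      rw [hverts] at h3
      rcases h3 with rfl | rfl
      · exact hqn.1 hw'
      · exact hpn.1 hw
  · ext w
    rw [SimpleGraph.Walk.mem_verts_toSubgraph, SimpleGraph.Walk.mem_support_append_iff, hps, hqs]
    rfl
  · rw [SimpleGraph.Walk.mem_edges_toSubgraph, SimpleGraph.Walk.edges_append, List.mem_append,
      hpe, hqe]
    tauto

/-- A SEAC graph has a Hamiltonian cycle, formed by the edges which are not edges of
articulation. -/
theorem SEACBuild.exists_hamiltonian {V : Type*} {G : SimpleGraph V} {H : G.Subgraph}
    {C : Set G.Subgraph} {E : Set (Sym2 V)} (h : SEACBuild H C E) :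
    ∃ Z : G.Subgraph, IsCycleSubgraph Z ∧ Z.verts = H.verts ∧
      ∀ e, e ∈ Z.edgeSet ↔ e ∈ H.edgeSet ∧ e ∉ E := by
  induction h with
  | cycle Z hZ => exact ⟨Z, hZ, rfl, by simp⟩
  | glue H C E Z u v hH hZ huvH huvZ hverts hnew ih =>
    obtain ⟨Z', hZ', hZ'v, hZ'e⟩ := ih
    obtain ⟨Y, hY, hYv, hYe⟩ := hZ'.exists_merge hZ ((hZ'e s(u, v)).2 ⟨huvH, hnew⟩) huvZ
      (hZ'v ▸ hverts)
    refine ⟨Y, hY, by rw [hYv, hZ'v, SimpleGraph.Subgraph.verts_sup], fun e => ?_⟩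
    have hboth : e ∈ Z.edgeSet → e ∈ E → e = s(u, v) := fun h1 h2 =>
      SimpleGraph.Subgraph.eq_of_mem_edgeSet_of_inter_eq_pair hverts (hH.subset_edgeSet h2) h1
    rw [hYe, hZ'e, SimpleGraph.Subgraph.edgeSet_sup, Set.mem_union, Set.mem_insert_iff]
    tauto

/-! ### Ears -/

/-- A walk from outside `U` into `U` has an initial segment outside `U` ending next to `U`. -/
theorem SimpleGraph.Walk.exists_initial_segment {V : Type*} {G : SimpleGraph V} {U : Set V}
    {a t : V} (r : G.Walk a t) (ha : a ∉ U) (ht : t ∈ U) :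
    ∃ b v, ∃ q : G.Walk a b, (∀ w ∈ q.support, w ∉ U) ∧ v ∈ U ∧ G.Adj b v := by
  induction r with
  | nil => exact absurd ht ha
  | @cons a c _ h p ih =>
    by_cases hc : c ∈ U
    · exact ⟨a, c, .nil, by simpa using ha, hc, h⟩
    · obtain ⟨b, v, q, hq, hv, hbv⟩ := ih hc ht
      refine ⟨b, v, .cons h q, ?_, hv, hbv⟩
      simpa [ha] using hq

theorem SimpleGraph.Walk.mem_edges_of_length_le_one {V : Type*} {G : SimpleGraph V} {x y : V}
    (p : G.Walk x y) (hxy : x ≠ y) (hp : p.length ≤ 1) : s(x, y) ∈ p.edges := by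
  cases p with
  | nil => exact absurd rfl hxy
  | @cons _ z _ h q =>
    rw [SimpleGraph.Walk.length_cons] at hp
    have := SimpleGraph.Walk.eq_of_length_eq_zero (p := q) (by omega)
    subst this
    simp

/-- A walk which is shortest among the walks in its own support has no chords. -/
theorem SimpleGraph.Walk.mem_edges_of_adj_of_shortest {V : Type*} {G : SimpleGraph V} {a b : V}
    {q : G.Walk a b} (hq : ∀ q' : G.Walk a b, q'.support ⊆ q.support → q.length ≤ q'.length)
    {x y : V} (hx : x ∈ q.support) (hy : y ∈ q.support) (hxy : G.Adj x y) :
    s(x, y) ∈ q.edges := by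
  classical
  have hspec := q.take_spec hx
  generalize q.takeUntil x hx = p₁ at hspec
  generalize q.dropUntil x hx = p₂ at hspec
  subst hspec
  rcases (SimpleGraph.Walk.mem_support_append_iff _ _).1 hy with hy | hy
  · have hspec := p₁.take_spec hy
    generalize p₁.takeUntil y hy = r₁ at hspec
    generalize p₁.dropUntil y hy = r₂ at hspec
    subst hspec
    have h1 := hq (r₁.append (.cons hxy.symm p₂)) fun w => by
      simp only [SimpleGraph.Walk.mem_support_append_iff, SimpleGraph.Walk.support_cons,
        List.mem_cons]
      rintro (h | rfl | h)
      · exact Or.inl (Or.inl h)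
      · exact Or.inl (Or.inl r₁.end_mem_support)
      · exact Or.inr h
    simp only [SimpleGraph.Walk.length_append, SimpleGraph.Walk.length_cons] at h1
    have h2 := r₂.mem_edges_of_length_le_one hxy.ne' (by omega)
    rw [Sym2.eq_swap]
    simp only [SimpleGraph.Walk.edges_append, List.mem_append]
    exact Or.inl (Or.inr h2)
  · have hspec := p₂.take_spec hy
    generalize p₂.takeUntil y hy = r₁ at hspec
    generalize p₂.dropUntil y hy = r₂ at hspec
    subst hspec
    have h1 := hq (p₁.append (.cons hxy r₂)) fun w => by
      simp only [SimpleGraph.Walk.mem_support_append_iff, SimpleGraph.Walk.support_cons,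
        List.mem_cons]
      rintro (h | rfl | h)
      · exact Or.inl h
      · exact Or.inl p₁.end_mem_support
      · exact Or.inr (Or.inr h)
    simp only [SimpleGraph.Walk.length_append, SimpleGraph.Walk.length_cons] at h1
    have h2 := r₁.mem_edges_of_length_le_one hxy.ne (by omega)
    simp only [SimpleGraph.Walk.edges_append, List.mem_append]
    exact Or.inr (Or.inl h2)

/-- An ear of `U`: a path from `u ∈ U` to another `v ∈ U` whose interior, the support of the walk
`q`, is nonempty and lies outside `U`. -/
structure IsEar {V : Type*} {G : SimpleGraph V} (U : Set V) (u v : V) {a b : V}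
    (q : G.Walk a b) : Prop where
  left_mem : u ∈ U
  right_mem : v ∈ U
  ne : u ≠ v
  left_adj : G.Adj u a
  right_adj : G.Adj b v
  outside : ∀ w ∈ q.support, w ∉ U

theorem exists_isEar {V : Type*} {G : SimpleGraph V} (hG : G.Connected)
    (h2 : ∀ v x y, x ≠ v → y ≠ v → (G.deleteIncidenceSet v).Reachable x y) {U : Set V}
    (hU : ∃ x ∈ U, ∃ y ∈ U, x ≠ y) (hne : ∃ w, w ∉ U) :
    ∃ u v a b, ∃ q : G.Walk a b, IsEar U u v q := by
  obtain ⟨x, hx, y, hy, hxy⟩ := hU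
  obtain ⟨w, hw⟩ := hne
  obtain ⟨r⟩ := hG.preconnected w x
  obtain ⟨a, u, q, hq, hu, hau⟩ := r.exists_initial_segment hw hx
  have ha : a ∉ U := hq a q.end_mem_support
  obtain ⟨t, ht, htu⟩ : ∃ t ∈ U, t ≠ u := by
    by_cases h : x = u
    · exact ⟨y, hy, fun h' => hxy (h.trans h'.symm)⟩
    · exact ⟨x, hx, h⟩
  obtain ⟨r'⟩ := h2 u a t hau.ne htu
  obtain ⟨b, v, q', hq', hv, hbv⟩ := r'.exists_initial_segment ha ht
  rw [SimpleGraph.deleteIncidenceSet_adj] at hbv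
  refine ⟨u, v, a, b, q'.mapLe (G.deleteIncidenceSet_le u), hu, hv, hbv.2.2.symm, hau.symm,
    hbv.1, fun w hw => hq' w ?_⟩
  simpa using hw

/-- In a 2-connected graph with `M(G) ≤ 2`, let `U` be a proper vertex set such that any
two vertices of `U` are both joined to each of two disjoint connected sets in the rest of `U`,
unless they are adjacent by an edge not in `E`. A shortest ear of `U` closes up to a cycle through an edge of `U` not in `E`, and
there are no further edges between the cycle and `U`: otherwise there is a subdivision of `K₂,₃`, a
shorter ear, or a `K₄`. -/
theorem exists_cycle_of_two_connected {V : Type*} [Fintype V] {G : SimpleGraph V}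
    (hG : G.Connected) (h2 : ∀ v x y, x ≠ v → y ≠ v → (G.deleteIncidenceSet v).Reachable x y)
    (hM : maxMult G < 3) {U : Set V} {E : Set (Sym2 V)}
    (hU : ∃ x ∈ U, ∃ y ∈ U, x ≠ y) (hne : ∃ w, w ∉ U)
    (hsep : ∀ x ∈ U, ∀ y ∈ U, x ≠ y → ¬ (G.Adj x y ∧ s(x, y) ∉ E) →
      ∃ D₁ D₂ : Set V, Disjoint D₁ D₂ ∧ ∀ D, (D = D₁ ∨ D = D₂) →
        D ⊆ U \ {x, y} ∧ (G.induce D).Preconnected ∧ (∃ a ∈ D, G.Adj x a) ∧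
          ∃ b ∈ D, G.Adj y b) :
    ∃ u v, ∃ Z : G.Subgraph, G.Adj u v ∧ s(u, v) ∉ E ∧ IsCycleSubgraph Z ∧ Z.Adj u v ∧
      U ∩ Z.verts = {u, v} ∧ (∃ w ∈ Z.verts, w ∉ U) ∧
      ∀ x ∈ U ∪ Z.verts, ∀ y ∈ U ∪ Z.verts, G.Adj x y → (x ∈ U ∧ y ∈ U) ∨ Z.Adj x y := by
  classical
  -- The interior of an ear is a third connected set, so the ends of an ear are adjacent.
  have hends : ∀ {u v a b : V} {q : G.Walk a b}, IsEar U u v q → G.Adj u v ∧ s(u, v) ∉ E := by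
    intro u v a b q hq
    by_contra hcon
    obtain ⟨D₁, D₂, hD, hDs⟩ := hsep u hq.left_mem v hq.right_mem hq.ne hcon
    obtain ⟨hD₁, hc₁, ha₁, hb₁⟩ := hDs D₁ (Or.inl rfl)
    obtain ⟨hD₂, hc₂, ha₂, hb₂⟩ := hDs D₂ (Or.inr rfl)
    have hout : ∀ D ⊆ U \ {u, v}, Disjoint D {w | w ∈ q.support} := fun D hDU =>
      Set.disjoint_left.2 fun w hw hw' => hq.outside w hw' (hDU hw).1
    refine absurd (three_le_maxMult_of_theta hq.ne ![D₁, D₂, {w | w ∈ q.support}]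
      ?_ ?_ ?_ ?_ ?_ ?_) (not_le.2 hM)
    · intro i j hij
      fin_cases i <;> fin_cases j <;>
        first
        | exact absurd rfl hij
        | exact hD
        | exact hD.symm
        | exact hout _ hD₁
        | exact hout _ hD₂
        | exact (hout _ hD₁).symm
        | exact (hout _ hD₂).symm
    · intro i
      fin_cases i
      · exact hc₁
      · exact hc₂
      · exact q.connected_induce_support.preconnected
    · intro i
      fin_cases i
      · exact fun h => (hD₁ h).2 (by simp)
      · exact fun h => (hD₂ h).2 (by simp)
      · exact fun h => hq.outside u h hq.left_mem
    · intro i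
      fin_cases i
      · exact fun h => (hD₁ h).2 (by simp)
      · exact fun h => (hD₂ h).2 (by simp)
      · exact fun h => hq.outside v h hq.right_mem
    · intro i
      fin_cases i
      · exact ha₁
      · exact ha₂
      · exact ⟨a, q.start_mem_support, hq.left_adj⟩
    · intro i
      fin_cases i
      · exact hb₁
      · exact hb₂
      · exact ⟨b, q.end_mem_support, hq.right_adj.symm⟩
  obtain ⟨u, v, a, b, q, hq, hmin⟩ : ∃ u v a b, ∃ q : G.Walk a b, IsEar U u v q ∧
      ∀ u' v' a' b', ∀ q' : G.Walk a' b', IsEar U u' v' q' → q.length ≤ q'.length := by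
    have hex : ∃ n u v a b, ∃ q : G.Walk a b, IsEar U u v q ∧ q.length = n := by
      obtain ⟨u, v, a, b, q, hq⟩ := exists_isEar hG h2 hU hne
      exact ⟨_, u, v, a, b, q, hq, rfl⟩
    obtain ⟨u, v, a, b, q, hq, hn⟩ := Nat.find_spec hex
    exact ⟨u, v, a, b, q, hq, fun u' v' a' b' q' hq' =>
      hn ▸ Nat.find_min' hex ⟨u', v', a', b', q', hq', rfl⟩⟩
  obtain ⟨huv, huvE⟩ := hends hq
  have hshort : ∀ q' : G.Walk a b, q'.support ⊆ q.support → q.length ≤ q'.length :=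
    fun q' hq' => hmin u v a b q' { hq with outside := fun w hw => hq.outside w (hq' hw) }
  have hpath : q.IsPath := by
    have h1 := hshort q.bypass q.support_bypass_subset_support
    rw [← SimpleGraph.Walk.bypass_eq_self_of_length_le_length_bypass q h1]
    exact q.bypass_isPath
  -- The only edges between the interior of the ear and `U` are the two end edges of the ear.
  have hattach : ∀ w ∈ q.support, ∀ h ∈ U, G.Adj w h → (w = a ∧ h = u) ∨ (w = b ∧ h = v) := by
    intro w hw h hh hwh
    have hwb : h ≠ u → w = b := fun hhu => by
      have h1 := hmin u h a w (q.takeUntil w hw) ⟨hq.left_mem, hh, hhu.symm, hq.left_adj, hwh,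
        fun z hz => hq.outside z (q.support_takeUntil_subset_support hw hz)⟩
      by_contra hne
      have h2 := q.length_takeUntil_lt_length hw hne
      omega
    have hwa : h ≠ v → w = a := fun hhv => by
      have h1 := hmin h v w b (q.dropUntil w hw) ⟨hh, hq.right_mem, hhv, hwh.symm, hq.right_adj,
        fun z hz => hq.outside z (q.support_dropUntil_subset_support hw hz)⟩
      by_contra hne
      have h2 := q.length_dropUntil_lt_length hw hne
      omega
    by_cases hhu : h = u
    · exact Or.inl ⟨hwa fun h' => hq.ne (hhu.symm.trans h'), hhu⟩
    · by_cases hhv : h = v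
      · exact Or.inr ⟨hwb hhu, hhv⟩
      · have hw1 := hwa hhv
        have hw2 := hwb hhu
        have hwU : w ∉ U := hq.outside w hw
        have hwu : G.Adj w u := hw1 ▸ hq.left_adj.symm
        have hwv : G.Adj w v := hw2 ▸ hq.right_adj
        have hnil : ∀ z ∈ (SimpleGraph.Walk.nil : G.Walk w w).support, z ∉ U := fun z hz => by
          rw [SimpleGraph.Walk.support_nil, List.mem_singleton] at hz
          exact hz ▸ hwU
        have huh := (hends (q := .nil) ⟨hq.left_mem, hh, Ne.symm hhu, hwu.symm, hwh, hnil⟩).1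
        have hvh := (hends (q := .nil) ⟨hq.right_mem, hh, Ne.symm hhv, hwv.symm, hwh, hnil⟩).1
        exact absurd (three_le_maxMult_of_complete_four huv huh hwu.symm hvh hwv.symm hwh.symm)
          (not_le.2 hM)
  have hu : u ∉ q.support := fun h => hq.outside u h hq.left_mem
  have hv : v ∉ q.support := fun h => hq.outside v h hq.right_mem
  have hcyc : (SimpleGraph.Walk.cons huv.symm
      (.cons hq.left_adj (q.concat hq.right_adj))).IsCycle := by
    rw [SimpleGraph.Walk.cons_isCycle_iff, SimpleGraph.Walk.cons_isPath_iff,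
      SimpleGraph.Walk.concat_isPath_iff]
    refine ⟨⟨⟨hpath, hv⟩, ?_⟩, ?_⟩
    · rw [SimpleGraph.Walk.support_concat, List.mem_append, List.mem_singleton, not_or]
      exact ⟨hu, hq.ne⟩
    · rw [SimpleGraph.Walk.edges_cons, SimpleGraph.Walk.edges_concat, List.mem_cons,
        List.concat_eq_append, List.mem_append, List.mem_singleton]
      rintro (h | h | h)
      · rcases Sym2.eq_iff.1 h with ⟨h, -⟩ | ⟨h, -⟩
        · exact hq.ne h.symm
        · exact hv (h ▸ q.start_mem_support)
      · exact hv (q.fst_mem_support_of_mem_edges h)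
      · rcases Sym2.eq_iff.1 h with ⟨h, -⟩ | ⟨-, h⟩
        · exact hv (h ▸ q.end_mem_support)
        · exact hu (h ▸ q.end_mem_support)
  have hZv : ∀ w, w ∈ (SimpleGraph.Walk.cons huv.symm
      (.cons hq.left_adj (q.concat hq.right_adj))).toSubgraph.verts ↔
      w = u ∨ w = v ∨ w ∈ q.support := fun w => by
    rw [SimpleGraph.Walk.mem_verts_toSubgraph]
    simp only [SimpleGraph.Walk.support_cons, SimpleGraph.Walk.support_concat, List.mem_cons,
      List.mem_append]
    tauto
  have hZe : ∀ x y, (SimpleGraph.Walk.cons huv.symm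
      (.cons hq.left_adj (q.concat hq.right_adj))).toSubgraph.Adj x y ↔
      s(x, y) = s(v, u) ∨ s(x, y) = s(u, a) ∨ s(x, y) ∈ q.edges ∨ s(x, y) = s(b, v) :=
    fun x y => by
    rw [← SimpleGraph.Subgraph.mem_edgeSet, SimpleGraph.Walk.mem_edges_toSubgraph]
    simp only [SimpleGraph.Walk.edges_cons, SimpleGraph.Walk.edges_concat, List.mem_cons,
      List.mem_append, List.concat_eq_append, List.not_mem_nil, or_false]
  refine ⟨u, v, _, huv, huvE, ⟨v, _, hcyc, rfl⟩, (hZe u v).2 (Or.inl Sym2.eq_swap), ?_,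
    ⟨a, (hZv a).2 (by simp), hq.outside a q.start_mem_support⟩, ?_⟩
  · ext w
    rw [Set.mem_inter_iff, hZv, Set.mem_insert_iff, Set.mem_singleton_iff]
    constructor
    · rintro ⟨h1, h2 | h2 | h2⟩
      · exact Or.inl h2
      · exact Or.inr h2
      · exact absurd h1 (hq.outside w h2)
    · rintro (rfl | rfl)
      · exact ⟨hq.left_mem, by simp⟩
      · exact ⟨hq.right_mem, by simp⟩
  · have hcase : ∀ x, x ∈ U ∪ (SimpleGraph.Walk.cons huv.symm
        (.cons hq.left_adj (q.concat hq.right_adj))).toSubgraph.verts →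
        x ∈ U ∨ x ∈ q.support := fun x hx => by
      rcases hx with hx | hx
      · exact Or.inl hx
      · rcases (hZv x).1 hx with rfl | rfl | hx
        · exact Or.inl hq.left_mem
        · exact Or.inl hq.right_mem
        · exact Or.inr hx
    intro x hx y hy hxy
    rw [hZe]
    rcases hcase x hx with hx | hx <;> rcases hcase y hy with hy | hy
    · exact Or.inl ⟨hx, hy⟩
    · rcases hattach y hy x hx hxy.symm with ⟨rfl, rfl⟩ | ⟨rfl, rfl⟩
      · exact Or.inr (Or.inr (Or.inl rfl))
      · exact Or.inr (Or.inr (Or.inr (Or.inr Sym2.eq_swap)))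
    · rcases hattach x hx y hy hxy with ⟨rfl, rfl⟩ | ⟨rfl, rfl⟩
      · exact Or.inr (Or.inr (Or.inl Sym2.eq_swap))
      · exact Or.inr (Or.inr (Or.inr (Or.inr rfl)))
    · exact Or.inr (Or.inr (Or.inr (Or.inl
        (SimpleGraph.Walk.mem_edges_of_adj_of_shortest hshort hx hy hxy))))

/-- Starting from an edge, an induced SEAC subgraph can be enlarged until it is the whole graph. -/
theorem isSEAC_of_two_connected {V : Type*} [Fintype V] {G : SimpleGraph V} (hG : G.Connected)
    (hdeg : ∀ x, ∃ a b, a ≠ b ∧ G.Adj x a ∧ G.Adj x b)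
    (h2 : ∀ v x y, x ≠ v → y ≠ v → (G.deleteIncidenceSet v).Reachable x y)
    (hM : maxMult G < 3) : IsSEAC G := by
  classical
  have hstart : ∃ (H : G.Subgraph) (C : Set G.Subgraph) (E : Set (Sym2 V)), SEACBuild H C E ∧
      ∀ x ∈ H.verts, ∀ y ∈ H.verts, G.Adj x y → H.Adj x y := by
    obtain ⟨x⟩ := hG.nonempty
    obtain ⟨y, z, hyz, hxy, hxz⟩ := hdeg x
    obtain ⟨u, v, Z, huv, -, hZ, hZuv, hint, -, hind⟩ := exists_cycle_of_two_connected hG h2 hM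
      (U := {x, y}) (E := ∅) ⟨x, by simp, y, by simp, hxy.ne⟩
      ⟨z, by simp [hxz.ne', hyz.symm]⟩ (by
        rintro p (rfl | rfl) q (rfl | rfl) hpq hn
        · exact absurd rfl hpq
        · exact absurd ⟨hxy, Set.notMem_empty _⟩ hn
        · exact absurd ⟨hxy.symm, Set.notMem_empty _⟩ hn
        · exact absurd rfl hpq)
    refine ⟨Z, {Z}, ∅, .cycle Z hZ, fun p hp q hq hpq => ?_⟩
    rcases hind p (Or.inr hp) q (Or.inr hq) hpq with ⟨hp', hq'⟩ | h
    · have hp2 : p ∈ ({u, v} : Set V) := hint ▸ ⟨hp', hp⟩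
      have hq2 : q ∈ ({u, v} : Set V) := hint ▸ ⟨hq', hq⟩
      rcases hp2 with rfl | rfl <;> rcases hq2 with rfl | rfl
      · exact absurd rfl hpq.ne
      · exact hZuv
      · exact hZuv.symm
      · exact absurd rfl hpq.ne
    · exact h
  have hgrow : ∀ n, ∀ (H : G.Subgraph) (C : Set G.Subgraph) (E : Set (Sym2 V)),
      SEACBuild H C E → (∀ x ∈ H.verts, ∀ y ∈ H.verts, G.Adj x y → H.Adj x y) →
      (H.verts)ᶜ.ncard = n → IsSEAC G := by
    intro n
    induction n using Nat.strong_induction_on with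
    | _ n ih =>
      intro H C E hH hind hn
      by_cases hne : ∃ w, w ∉ H.verts
      · obtain ⟨Y, hY, hYv, hYe⟩ := hH.exists_hamiltonian
        obtain ⟨u, v, Z, huv, huvE, hZ, hZuv, hint, ⟨w, hwZ, hwH⟩, hind'⟩ :=
          exists_cycle_of_two_connected hG h2 hM (U := H.verts) (E := E)
          (by
            obtain ⟨x, hx⟩ := hY.nonempty
            obtain ⟨y, hy⟩ : (Y.neighborSet x).Nonempty := by
              obtain ⟨r, c, hc, rfl⟩ := hY
              refine Set.nonempty_of_ncard_ne_zero ?_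
              rw [hc.ncard_neighborSet_toSubgraph_eq_two (by simpa using hx)]
              norm_num
            rw [← hYv]
            exact ⟨x, hx, y, Y.edge_vert hy.symm, hy.ne⟩)
          hne (fun x hx y hy hxy hn => by
            rw [← hYv] at hx hy ⊢
            refine hY.exists_arcs hx hy hxy fun h => hn ?_
            have h' := (hYe s(x, y)).1 h
            exact ⟨h.adj_sub, h'.2⟩)
        have huH : u ∈ H.verts ∩ Z.verts := hint ▸ Set.mem_insert _ _
        have hvH : v ∈ H.verts ∩ Z.verts := hint ▸ Set.mem_insert_of_mem _ rfl
        refine ih _ ?_ (H ⊔ Z) _ _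
          (.glue H C E Z u v hH hZ (hind u huH.1 v hvH.1 huv) hZuv hint huvE) ?_ rfl
        · rw [← hn]
          refine Set.ncard_lt_ncard ⟨?_, fun h => ?_⟩ (Set.toFinite _)
          · exact Set.compl_subset_compl.2 Set.subset_union_left
          · exact h hwH (Or.inr hwZ)
        · intro x hx y hy hxy
          rcases hind' x hx y hy hxy with ⟨h1, h2⟩ | h
          · exact Or.inl (hind x h1 y h2 hxy)
          · exact Or.inr h
      · push Not at hne
        have htop : H = ⊤ := by
          ext x y
          · simp [hne]
          · rw [SimpleGraph.Subgraph.top_adj]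
            exact ⟨fun h => h.adj_sub, hind x (hne x) y (hne y)⟩
        subst htop
        exact ⟨C, E, hH⟩
  obtain ⟨H, C, E, hH, hind⟩ := hstart
  exact hgrow _ H C E hH hind rfl

theorem lemma4p7 {V : Type*} [Fintype V] (G : SimpleGraph V) [DecidableRel G.Adj] :
    (IsC2 G → maxMult G = 2 → IsSEAC G ∧ IsLSEAC G) ∧
    (∀ (C : Set G.Subgraph) (E : Set (Sym2 V)), IsSEACConstruction G C E →
      ∀ Z ∈ C, ∀ k : ℕ, 3 ≤ k → (cycleNeighbors C E Z).ncard = k → k ≤ maxMult G) := by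
  have hpart : ∀ (C : Set G.Subgraph) (E : Set (Sym2 V)), IsSEACConstruction G C E →
      ∀ Z ∈ C, (cycleNeighbors C E Z).ncard ≤ maxMult G :=
    fun C E h Z hZ => h.ncard_cycleNeighbors_le_maxMult hZ
  refine ⟨fun ⟨hG, hdeg⟩ hM => ?_, fun C E h Z hZ k _ hk => hk ▸ hpart C E h Z hZ⟩
  have hdeg' : ∀ x, ∃ a b, a ≠ b ∧ G.Adj x a ∧ G.Adj x b := fun x => by
    obtain ⟨a, b, ha, hb, hab⟩ := Finset.one_lt_card_iff.1 (hdeg x)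
    exact ⟨a, b, hab, by simpa using ha, by simpa using hb⟩
  have h2 : ∀ v x y, x ≠ v → y ≠ v → (G.deleteIncidenceSet v).Reachable x y := by
    intro v x y hx hy
    by_contra hxy
    have := three_le_maxMult_of_cut_vertex hG hdeg' hx hy hxy
    omega
  have hS := isSEAC_of_two_connected hG hdeg' h2 (by omega)
  exact ⟨hS, hS, fun C E h Z hZ => hM ▸ hpart C E h Z hZ⟩
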